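/- For integers $X,H,y>1$ (with $p$ denoting primes) let $\alpha_y(n)=1$ if every prime dividing $n$ is $>y$ and $\alpha_y(n)=0$ otherwise, let $P_y=\prod_{p\le y}(1-1/p)$, and define \[ V(X,H,y)=\frac1X\int_0^X\Bigl(\sum_{x<n\le x+H}\alpha_y(n)-HP_y\Bigr)^2dx, \] \[ M(H,y)=\prod_{2<p\le y}\Bigl(1-\frac2p\Bigr)\sum_{n\ge1}g_y(n)\Bigl\{\frac{H}{2n}\Bigr\}\Bigl(1-\Bigl\{\frac{H}{2n}\Bigr\}\Bigr), \] where $\{t\}$ is the fractional part of $t$ and $g_y$ is the multiplicative function supported on squarefree integers with $g_y(p)=p/(p-2)$ if $2<p\le y$ and $g_y(p)=0$ for all other primes $p$. Theorem. Fix $\varepsilon>0$ and $\delta>0$. Suppose that integers $y,H,X$ with $1<y\le X$ and $1<H\le X$ tend to infinity in such a way that $y\ge(\log H)^{1+\varepsilon}$ and, with $a=\log\log H/\log y$, \[ (1+a)\frac{\log H}{\log\log H}\le(1-\delta)\frac{\log X}{\log y}. \] Then $V(X,H,y)\sim M(H,y)$. -/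

import Mathlib

open Filter Asymptotics

noncomputable section

namespace RoughVariance

open Classical in
/-- The indicator function `α_y` of the integers all of whose prime factors exceed `y`. -/
def roughInd (y n : ℕ) : ℝ :=
  if ∀ p : ℕ, p.Prime → p ∣ n → y < p then 1 else 0

/-- The density `∏_{p ≤ y} (1 - 1/p)` of the integers without prime factors up to `y`. -/
def roughDensity (y : ℕ) : ℝ :=
  ∏ p ∈ (Finset.Icc 1 y).filter Nat.Prime, (1 - 1 / (p : ℝ))

/-- The number of `y`-rough integers `n` with `x < n ≤ x + H`, for real `x ≥ 0`. -/
def roughCount (H y : ℕ) (x : ℝ) : ℝ :=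
  ∑ n ∈ Finset.Ioc ⌊x⌋₊ ⌊x + (H : ℝ)⌋₊, roughInd y n

/-- The variance `V(X, H, y)` of the count of `y`-rough integers in intervals `(x, x + H]`. -/
def V (X H y : ℕ) : ℝ :=
  1 / (X : ℝ) * ∫ x in (0 : ℝ)..(X : ℝ), (roughCount H y x - (H : ℝ) * roughDensity y) ^ 2

/-- The values of `g_y` at primes. -/
def gPrime (y p : ℕ) : ℝ :=
  if 2 < p ∧ p ≤ y then (p : ℝ) / ((p : ℝ) - 2) else 0

/-- The multiplicative function `g_y`, supported on squarefree integers, with the values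
`gPrime y p` at primes `p`. -/
def g (y n : ℕ) : ℝ :=
  if Squarefree n then ∏ p ∈ n.primeFactors, gPrime y p else 0

/-- The main term `M(H, y)`. The term `n = 0` of the series vanishes, since `g y 0 = 0`, and
only finitely many terms are non-zero. -/
def M (H y : ℕ) : ℝ :=
  (∏ p ∈ (Finset.Icc 3 y).filter Nat.Prime, (1 - 2 / (p : ℝ))) *
    ∑' n : ℕ, g y n * Int.fract ((H : ℝ) / (2 * (n : ℝ))) *
      (1 - Int.fract ((H : ℝ) / (2 * (n : ℝ))))

theorem g_zero (y : ℕ) : g y 0 = 0 := by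
  simp [g]

/-- The function `g_y` has finite support. -/
theorem finite_support_g (y : ℕ) : (Function.support (g y)).Finite := by
  refine (Set.finite_Iic (primorial y)).subset fun n hn => ?_
  have hsq : Squarefree n := by
    by_contra h
    exact hn (by simp [g, h])
  have hp : ∏ p ∈ n.primeFactors, gPrime y p ≠ 0 := by
    intro h
    exact hn (by simp [g, h])
  have hle : ∀ p ∈ n.primeFactors, p ≤ y := by
    intro p hpn
    by_contra hy
    exact (Finset.prod_ne_zero_iff.mp hp p hpn) (by simp [gPrime, hy])
  have hsub : n.primeFactors ⊆ (Finset.range (y + 1)).filter Nat.Prime := by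
    intro p hpn
    simp only [Finset.mem_filter, Finset.mem_range]
    exact ⟨Nat.lt_succ_of_le (hle p hpn), Nat.prime_of_mem_primeFactors hpn⟩
  have hdvd : n ∣ primorial y := by
    rw [← Nat.prod_primeFactors_of_squarefree hsq]
    exact Finset.prod_dvd_prod_of_subset _ _ _ hsub
  exact Nat.le_of_dvd (primorial_pos y) hdvd

end RoughVariance

end

noncomputable section

namespace RoughVariance

/-! ### Truncated inclusion-exclusion -/

/-! Write `P` for `roughDensity y` and `a = log log H / log y`. Expanding the square expresses `V`
through the frequencies with which `(m + i) * (m + j)` has no prime factor up to `y`, for `1 ≤ i, j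
≤ H` (`V_eq_pairCount`). If each frequency is replaced by its local density `pairDensity`, the
result is exactly `M` (`sum_sum_pairDensity`). Hence `|V - M|` is at most `3 * H ^ 2` times the
worst error for a single pair, and that error has to be small compared with `M / H ^ 2`.

The error for a pair comes from a Brun-Hooley sieve (`brun_hooley`). The primes up to `y` are cut
into blocks, block `l` lying roughly between `y ^ (1 / T ^ (l + 1))` and `y ^ (1 / T ^ l)` with `T =
k + 4`, and inclusion-exclusion in block `l` stops at `k * 2 ^ l` primes. The block of the largest
primes costs about `y ^ (k + 1)`; all the others together cost at most `y ^ 24`. So `X ≥ y ^ (k +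
28)` suffices for an error of `O(P * sieveSaving k)` (`abs_pairCount_div_sub_le`), and `sieveSaving
k` is at most `k ^ (-(1 - o(1)) * k)` (`eventually_sieveSaving_le`).

The main term is at least `P * H ^ (1 - a - o(1))` (`eventually_le_M`). Only the sets of odd primes
with product at least `H` are kept. If `y > H ^ 2`, the primes between `H` and `H ^ 2` already
supply enough of them; otherwise sets of about `log H / log y` primes close to `y` do.

Comparing `H ^ 2 * P * k ^ (-k)` with `P * H ^ (1 - a)` shows that `k * log k` must exceed `(1 + a)
* log H`, so `k` is taken slightly above `(1 + a) * log H / log log H` (`exists_sieve_level`). The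
condition `y ^ (k + 28) ≤ X` is then what the hypothesis on `X` provides, with `δ` absorbing the
lower order losses. -/

/-- The sum of `c |S| * ∏ p ∈ S, x p` over the subsets `S` of `s`. -/
def weightedSum (c : ℕ → ℝ) (s : Finset ℕ) (x : ℕ → ℝ) : ℝ :=
  ∑ S ∈ s.powerset, c S.card * ∏ p ∈ S, x p

/-- The coefficients of inclusion-exclusion truncated after the subsets of size `k`. -/
def brunCoef (k i : ℕ) : ℝ := if i ≤ k then (-1) ^ i else 0

/-- The coefficients of the elementary symmetric function of degree `k`. -/
def esymmCoef (k i : ℕ) : ℝ := if i = k then 1 else 0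

theorem weightedSum_empty (c : ℕ → ℝ) (x : ℕ → ℝ) : weightedSum c ∅ x = c 0 := by
  simp [weightedSum]

/-- Split the subsets according to whether they contain `a`; those that do see the coefficients
shifted by one. -/
theorem weightedSum_insert (c : ℕ → ℝ) {s : Finset ℕ} {a : ℕ} (ha : a ∉ s) (x : ℕ → ℝ) :
    weightedSum c (insert a s) x =
      weightedSum c s x + x a * weightedSum (fun i => c (i + 1)) s x := by
  unfold weightedSum
  rw [Finset.sum_powerset_insert ha, Finset.mul_sum]
  congr 1
  refine Finset.sum_congr rfl fun S hS => ?_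
  have haS : a ∉ S := fun h => ha (Finset.mem_powerset.mp hS h)
  rw [Finset.card_insert_of_notMem haS, Finset.prod_insert haS]
  ring

theorem weightedSum_insert_brunCoef_succ (k : ℕ) {s : Finset ℕ} {a : ℕ} (ha : a ∉ s)
    (x : ℕ → ℝ) : weightedSum (brunCoef (k + 1)) (insert a s) x =
      weightedSum (brunCoef (k + 1)) s x - x a * weightedSum (brunCoef k) s x := by
  rw [weightedSum_insert _ ha]
  have : weightedSum (fun i => brunCoef (k + 1) (i + 1)) s x = -weightedSum (brunCoef k) s x := by
    unfold weightedSum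
    rw [← Finset.sum_neg_distrib]
    refine Finset.sum_congr rfl fun S _ => ?_
    simp only [brunCoef, add_le_add_iff_right]
    split_ifs <;> ring
  rw [this]; ring

theorem weightedSum_brunCoef_zero (s : Finset ℕ) (x : ℕ → ℝ) :
    weightedSum (brunCoef 0) s x = 1 := by
  induction s using Finset.induction_on with
  | empty => simp [weightedSum_empty, brunCoef]
  | insert a s ha ih =>
    rw [weightedSum_insert _ ha, ih]
    simp [weightedSum, brunCoef]

theorem weightedSum_insert_esymmCoef_succ (k : ℕ) {s : Finset ℕ} {a : ℕ} (ha : a ∉ s)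
    (x : ℕ → ℝ) : weightedSum (esymmCoef (k + 1)) (insert a s) x =
      weightedSum (esymmCoef (k + 1)) s x + x a * weightedSum (esymmCoef k) s x := by
  rw [weightedSum_insert _ ha]
  have : (fun i => esymmCoef (k + 1) (i + 1)) = esymmCoef k := by
    funext i; simp [esymmCoef]
  rw [this]

theorem weightedSum_esymmCoef_zero (s : Finset ℕ) (x : ℕ → ℝ) :
    weightedSum (esymmCoef 0) s x = 1 := by
  induction s using Finset.induction_on with
  | empty => simp [weightedSum_empty, esymmCoef]
  | insert a s ha ih =>
    rw [weightedSum_insert _ ha, ih]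
    simp [weightedSum, esymmCoef]

theorem weightedSum_esymmCoef_nonneg (k : ℕ) (s : Finset ℕ) {x : ℕ → ℝ}
    (hx : ∀ p ∈ s, 0 ≤ x p) : 0 ≤ weightedSum (esymmCoef k) s x := by
  refine Finset.sum_nonneg fun S hS => mul_nonneg ?_ (Finset.prod_nonneg fun p hp =>
    hx p (Finset.mem_powerset.mp hS hp))
  unfold esymmCoef
  split_ifs <;> norm_num

/-- Each squarefree monomial occurs `k!` times in the expansion of the `k`-th power. The induction
needs only the first two terms of the binomial expansion. -/
theorem weightedSum_esymmCoef_le (k : ℕ) (s : Finset ℕ) {x : ℕ → ℝ} (hx : ∀ p ∈ s, 0 ≤ x p) :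
    weightedSum (esymmCoef k) s x ≤ (∑ p ∈ s, x p) ^ k / k.factorial := by
  induction s using Finset.induction_on generalizing k with
  | empty =>
    rw [weightedSum_empty]
    rcases k with _ | k <;> simp [esymmCoef]
  | insert a s ha ih =>
    have hs : ∀ p ∈ s, 0 ≤ x p := fun p hp => hx p (Finset.mem_insert_of_mem hp)
    have hxa : 0 ≤ x a := hx a (Finset.mem_insert_self a s)
    rcases k with _ | k
    · rw [weightedSum_esymmCoef_zero]; simp
    · rw [weightedSum_insert_esymmCoef_succ k ha, Finset.sum_insert ha]
      have hσ : 0 ≤ ∑ p ∈ s, x p := Finset.sum_nonneg hs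
      set σ := ∑ p ∈ s, x p
      -- Bernoulli's inequality for `x a / σ`; the case `σ = 0` is separate.
      have hbin : σ ^ (k + 1) + (k + 1) * x a * σ ^ k ≤ (x a + σ) ^ (k + 1) := by
        rcases hσ.eq_or_lt with h0 | h0
        · rw [← h0]
          rcases k with _ | k
          · simp
          · simp; positivity
        · have := one_add_mul_le_pow (a := x a / σ) (by
            have : 0 ≤ x a / σ := by positivity
            linarith) (k + 1)
          have h2 := mul_le_mul_of_nonneg_left this (pow_nonneg h0.le (k + 1))
          rw [← mul_pow] at h2
          have e1 : σ * (1 + x a / σ) = x a + σ := by field_simp; ring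
          rw [e1] at h2
          refine le_trans (le_of_eq ?_) h2
          push_cast
          field_simp
          ring
      have h1 := ih (k + 1) hs
      have h2 := mul_le_mul_of_nonneg_left (ih k hs) hxa
      refine (add_le_add h1 h2).trans ?_
      rw [Nat.factorial_succ]
      have hf : (0 : ℝ) < k.factorial := by exact_mod_cast k.factorial_pos
      push_cast
      have e : σ ^ (k + 1) / ((k + 1 : ℝ) * k.factorial) + x a * (σ ^ k / k.factorial) =
          (σ ^ (k + 1) + (k + 1) * x a * σ ^ k) / ((k + 1 : ℝ) * k.factorial) := by
        field_simp
      rw [e]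
      gcongr

/-- The Bonferroni inequalities. -/
theorem bonferroni (k : ℕ) (s : Finset ℕ) {x : ℕ → ℝ} (h0 : ∀ p ∈ s, 0 ≤ x p)
    (h1 : ∀ p ∈ s, x p ≤ 1) :
    0 ≤ (-1) ^ k * (weightedSum (brunCoef k) s x - ∏ p ∈ s, (1 - x p)) ∧
      (-1) ^ k * (weightedSum (brunCoef k) s x - ∏ p ∈ s, (1 - x p)) ≤
        weightedSum (esymmCoef (k + 1)) s x := by
  induction s using Finset.induction_on generalizing k with
  | empty => simp [weightedSum_empty, brunCoef, esymmCoef]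
  | insert a s ha ih =>
    have h0s : ∀ p ∈ s, 0 ≤ x p := fun p hp => h0 p (Finset.mem_insert_of_mem hp)
    have h1s : ∀ p ∈ s, x p ≤ 1 := fun p hp => h1 p (Finset.mem_insert_of_mem hp)
    have hxa : 0 ≤ x a := h0 a (Finset.mem_insert_self a s)
    have hP0 : 0 ≤ ∏ p ∈ s, (1 - x p) := Finset.prod_nonneg fun p hp => by linarith [h1s p hp]
    have hP1 : ∏ p ∈ s, (1 - x p) ≤ 1 := Finset.prod_le_one (fun p hp => by linarith [h1s p hp])
      fun p hp => by linarith [h0s p hp]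
    rw [Finset.prod_insert ha, weightedSum_insert_esymmCoef_succ k ha]
    rcases k with _ | k
    · obtain ⟨i1, i2⟩ := ih 0 h0s h1s
      rw [weightedSum_brunCoef_zero] at i1 i2 ⊢
      rw [weightedSum_esymmCoef_zero]
      constructor <;> nlinarith
    · rw [weightedSum_insert_brunCoef_succ k ha]
      obtain ⟨i1, i2⟩ := ih (k + 1) h0s h1s
      obtain ⟨j1, j2⟩ := ih k h0s h1s
      -- The signed error satisfies the recursion of the elementary symmetric functions, with the
      -- nonnegative multiplier `x a`, so both bounds are inherited.
      have e : (-1 : ℝ) ^ (k + 1) * (weightedSum (brunCoef (k + 1)) s x -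
          x a * weightedSum (brunCoef k) s x - (1 - x a) * ∏ p ∈ s, (1 - x p)) =
          (-1 : ℝ) ^ (k + 1) * (weightedSum (brunCoef (k + 1)) s x - ∏ p ∈ s, (1 - x p)) +
          x a * ((-1 : ℝ) ^ k * (weightedSum (brunCoef k) s x - ∏ p ∈ s, (1 - x p))) := by
        rw [pow_succ]; ring
      rw [e]
      have m1 := mul_le_mul_of_nonneg_left j1 hxa
      have m2 := mul_le_mul_of_nonneg_left j2 hxa
      constructor <;> linarith

/-- Real values in `[0, 1]` are allowed because the inequality is used twice: for the indicators
`hit` at each `m`, and for the densities `nu / p`. -/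
theorem prod_le_weightedSum_brunCoef {k : ℕ} (hk : Even k) (s : Finset ℕ) {x : ℕ → ℝ}
    (h0 : ∀ p ∈ s, 0 ≤ x p) (h1 : ∀ p ∈ s, x p ≤ 1) :
    ∏ p ∈ s, (1 - x p) ≤ weightedSum (brunCoef k) s x := by
  have := (bonferroni k s h0 h1).1
  rw [hk.neg_one_pow] at this
  linarith

theorem weightedSum_brunCoef_sub_prod_le {k : ℕ} (hk : Even k) (s : Finset ℕ) {x : ℕ → ℝ}
    (h0 : ∀ p ∈ s, 0 ≤ x p) (h1 : ∀ p ∈ s, x p ≤ 1) :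
    weightedSum (brunCoef k) s x - ∏ p ∈ s, (1 - x p) ≤
      weightedSum (esymmCoef (k + 1)) s x := by
  have := (bonferroni k s h0 h1).2
  rw [hk.neg_one_pow] at this
  linarith

/-- Hooley's inequality for the difference of two products. -/
theorem prod_sub_prod_le_sum_prod {ι : Type*} [DecidableEq ι] (s : Finset ι) {x y w : ι → ℝ}
    (hx : ∀ j ∈ s, 0 ≤ x j) (hxy : ∀ j ∈ s, x j ≤ y j) (hw : ∀ j ∈ s, y j - x j ≤ w j) :
    ∏ j ∈ s, y j - ∏ j ∈ s, x j ≤ ∑ l ∈ s, ∏ j ∈ s, (if j = l then w j else y j) := by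
  induction s using Finset.induction_on with
  | empty => simp
  | insert a s ha ih =>
    have hxs : ∀ j ∈ s, 0 ≤ x j := fun p hp => hx p (Finset.mem_insert_of_mem hp)
    have hxys : ∀ j ∈ s, x j ≤ y j := fun p hp => hxy p (Finset.mem_insert_of_mem hp)
    have ih' := ih hxs hxys (fun p hp => hw p (Finset.mem_insert_of_mem hp))
    rw [Finset.prod_insert ha, Finset.prod_insert ha, Finset.sum_insert ha,
      Finset.prod_insert ha, if_pos rfl]
    have e1 : ∏ j ∈ s, (if j = a then w j else y j) = ∏ j ∈ s, y j :=
      Finset.prod_congr rfl fun j hj => if_neg (by rintro rfl; exact ha hj)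
    have e2 : ∑ l ∈ s, ∏ j ∈ insert a s, (if j = l then w j else y j) =
        y a * ∑ l ∈ s, ∏ j ∈ s, (if j = l then w j else y j) := by
      rw [Finset.mul_sum]
      refine Finset.sum_congr rfl fun l hl => ?_
      rw [Finset.prod_insert ha, if_neg (by rintro rfl; exact ha hl)]
    rw [e1, e2]
    have hxa := hx a (Finset.mem_insert_self a s)
    have hya := hxy a (Finset.mem_insert_self a s)
    have hwa := hw a (Finset.mem_insert_self a s)
    have hX0 : 0 ≤ ∏ j ∈ s, x j := Finset.prod_nonneg hxs
    have hXY : ∏ j ∈ s, x j ≤ ∏ j ∈ s, y j := Finset.prod_le_prod hxs hxys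
    -- With `X`, `Y` the products over `s`: `y a * Y - x a * X = y a * (Y - X) + (y a - x a) * X`,
    -- and `X ≤ Y`.
    nlinarith [mul_le_mul_of_nonneg_left ih' (hxa.trans hya),
      mul_le_mul_of_nonneg_right hwa (hX0.trans hXY),
      mul_nonneg (sub_nonneg.mpr hya) (sub_nonneg.mpr hXY)]

/-- A product of weighted sums over the finite sets `s j` as a single sum. -/
theorem prod_weightedSum {J : ℕ} (c : Fin J → ℕ → ℝ) (s : Fin J → Finset ℕ)
    (hs : Pairwise fun i j => Disjoint (s i) (s j)) (x : ℕ → ℝ) :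
    ∏ j, weightedSum (c j) (s j) x =
      ∑ φ ∈ Fintype.piFinset fun j => (s j).powerset,
        (∏ j, c j (φ j).card) * ∏ p ∈ Finset.univ.biUnion φ, x p := by
  unfold weightedSum
  rw [Finset.prod_univ_sum]
  refine Finset.sum_congr rfl fun φ hφ => ?_
  rw [Finset.prod_mul_distrib, Finset.prod_biUnion]
  intro i _ j _ hij
  rw [Fintype.mem_piFinset] at hφ
  exact Finset.disjoint_of_subset_left (Finset.mem_powerset.mp (hφ i))
    (Finset.disjoint_of_subset_right (Finset.mem_powerset.mp (hφ j)) (hs hij))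

/-- If the means of the products `∏ p ∈ S, b p m` over `m < X` are multiplicative up to `C ^ |S|`,
so are the means of products of weighted sums. -/
theorem abs_sum_prod_weightedSum_sub_le {J : ℕ} (c : Fin J → ℕ → ℝ) (s : Fin J → Finset ℕ)
    (hs : Pairwise fun i j => Disjoint (s i) (s j)) (X : ℕ) (b : ℕ → ℕ → ℝ) (ρ : ℕ → ℝ) (C : ℝ)
    (hb : ∀ S : Finset ℕ, (∀ p ∈ S, ∃ j, p ∈ s j) →
      |∑ m ∈ Finset.range X, ∏ p ∈ S, b m p - X * ∏ p ∈ S, ρ p| ≤ C ^ S.card) :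
    |∑ m ∈ Finset.range X, ∏ j, weightedSum (c j) (s j) (b m) -
        X * ∏ j, weightedSum (c j) (s j) ρ| ≤
      ∏ j, weightedSum (fun i => |c j i|) (s j) fun _ => C := by
  rw [prod_weightedSum _ s hs, prod_weightedSum _ s hs]
  simp_rw [prod_weightedSum c s hs]
  rw [Finset.sum_comm, Finset.mul_sum, ← Finset.sum_sub_distrib]
  refine (Finset.abs_sum_le_sum_abs _ _).trans (Finset.sum_le_sum fun φ hφ => ?_)
  rw [← Finset.mul_sum]
  have e : (∏ j, c j (φ j).card) * ∑ m ∈ Finset.range X, ∏ p ∈ Finset.univ.biUnion φ, b m p -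
      X * ((∏ j, c j (φ j).card) * ∏ p ∈ Finset.univ.biUnion φ, ρ p) =
      (∏ j, c j (φ j).card) * (∑ m ∈ Finset.range X, ∏ p ∈ Finset.univ.biUnion φ, b m p -
      X * ∏ p ∈ Finset.univ.biUnion φ, ρ p) := by ring
  rw [e, abs_mul, Finset.abs_prod, Finset.prod_const]
  refine mul_le_mul_of_nonneg_left (hb _ fun p hp => ?_)
    (Finset.prod_nonneg fun j _ => abs_nonneg _)
  rw [Finset.mem_biUnion] at hp
  obtain ⟨j, -, hj⟩ := hp
  rw [Fintype.mem_piFinset] at hφ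
  exact ⟨j, Finset.mem_powerset.mp (hφ j) hj⟩

/-! ### Counting solutions of simultaneous congruences -/

theorem abs_sum_modEq_sub_le (X c : ℕ) {d : ℕ} (hd : 0 < d) :
    |∑ m ∈ Finset.range X, (if m ≡ c [MOD d] then (1 : ℝ) else 0) - X / d| ≤ 1 := by
  have h := Nat.count_modEq_card_eq_ceil (b := X) hd c
  rw [Finset.sum_boole, ← Nat.count_eq_card_filter_range]
  have hd' : (0 : ℝ) < d := by exact_mod_cast hd
  have hlt : ((c % d : ℕ) : ℝ) < d := by exact_mod_cast Nat.mod_lt c hd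
  have h0 : (0 : ℝ) ≤ ((c % d : ℕ) : ℝ) := by positivity
  have h' : (((X.count (· ≡ c [MOD d]) : ℕ) : ℤ) : ℝ) =
      ((⌈(X - (c % d : ℕ)) / (d : ℚ)⌉ : ℤ) : ℝ) := by rw [h]
  have h1 : ((X : ℝ) - (c % d : ℕ)) / d ≤ ((⌈(X - (c % d : ℕ)) / (d : ℚ)⌉ : ℤ) : ℝ) := by
    exact_mod_cast Int.le_ceil ((X - (c % d : ℕ)) / (d : ℚ))
  have h2 : ((⌈(X - (c % d : ℕ)) / (d : ℚ)⌉ : ℤ) : ℝ) < ((X : ℝ) - (c % d : ℕ)) / d + 1 := by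
    exact_mod_cast Int.ceil_lt_add_one ((X - (c % d : ℕ)) / (d : ℚ))
  rw [← h', Int.cast_natCast, sub_div] at h1 h2
  have h3 : ((c % d : ℕ) : ℝ) / d ≤ 1 := by rw [div_le_one hd']; exact hlt.le
  have h4 : 0 ≤ ((c % d : ℕ) : ℝ) / d := by positivity
  rw [abs_le]
  constructor <;> linarith

/-- The indicator function of `p ∣ (m + i) * (m + j)`, for `p` prime. -/
def hit (i j m p : ℕ) : ℝ := if p ∣ m + i ∨ p ∣ m + j then 1 else 0

/-- The number of residue classes modulo `p` that are removed by `hit i j`. -/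
def nu (i j p : ℕ) : ℕ := if i ≡ j [MOD p] then 1 else 2

/-- The residues modulo `p` that are removed by `hit i j`. -/
def hitResidues (i j p : ℕ) : Finset ℕ := {r ∈ Finset.range p | p ∣ r + i ∨ p ∣ r + j}

theorem dvd_add_iff_of_lt {p r : ℕ} (i : ℕ) (hr : r < p) :
    p ∣ r + i ↔ r = (p - i % p) % p := by
  have hp : 0 < p := by omega
  have hi := Nat.mod_lt i hp
  have h1 : p ∣ r + i ↔ p ∣ r + i % p := by
    conv_lhs => rw [← Nat.div_add_mod i p, ← add_assoc, add_comm r, add_assoc]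
    exact Nat.dvd_add_right (Dvd.intro _ rfl)
  rw [h1]
  rcases Nat.eq_zero_or_pos (i % p) with h0 | h0
  · rw [h0]; simp only [add_zero, tsub_zero, Nat.mod_self]
    exact ⟨fun h => Nat.eq_zero_of_dvd_of_lt h hr, fun h => h ▸ dvd_zero p⟩
  · rw [Nat.mod_eq_of_lt (by omega : p - i % p < p)]
    constructor
    · rintro ⟨k, hk⟩
      have : k = 1 := by
        rcases k with _ | _ | k
        · omega
        · rfl
        · exfalso
          have : p * (k + 1 + 1) = p * k + p + p := by ring
          have : 0 ≤ p * k := Nat.zero_le _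
          omega
      subst this; omega
    · rintro rfl
      exact ⟨1, by omega⟩

/-- The removed residues are `-i` and `-j`, which coincide exactly when `i ≡ j`. -/
theorem card_hitResidues (i j : ℕ) {p : ℕ} (hp : 0 < p) :
    (hitResidues i j p).card = nu i j p := by
  have e : hitResidues i j p = {(p - i % p) % p, (p - j % p) % p} := by
    ext r
    simp only [hitResidues, Finset.mem_filter, Finset.mem_range, Finset.mem_insert,
      Finset.mem_singleton]
    constructor
    · rintro ⟨hr, h⟩
      rwa [dvd_add_iff_of_lt i hr, dvd_add_iff_of_lt j hr] at h
    · intro h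
      have hr : r < p := by rcases h with rfl | rfl <;> exact Nat.mod_lt _ hp
      rw [dvd_add_iff_of_lt i hr, dvd_add_iff_of_lt j hr]
      exact ⟨hr, h⟩
  rw [e, nu]
  have hi := Nat.mod_lt i hp
  have hj := Nat.mod_lt j hp
  split_ifs with h
  · have h' : i % p = j % p := h
    rw [h']; simp
  · refine Finset.card_pair fun h' => h ?_
    have hr : (p - i % p) % p < p := Nat.mod_lt _ hp
    have d1 := (dvd_add_iff_of_lt i hr).mpr rfl
    have d2 := (dvd_add_iff_of_lt j hr).mpr h'
    have : (p - i % p) % p + i ≡ (p - i % p) % p + j [MOD p] :=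
      ((Nat.modEq_zero_iff_dvd.mpr d1).trans (Nat.modEq_zero_iff_dvd.mpr d2).symm)
    exact Nat.ModEq.add_left_cancel' _ this

theorem hit_eq_sum (i j m : ℕ) {p : ℕ} (hp : 0 < p) :
    hit i j m p = ∑ r ∈ hitResidues i j p, if m ≡ r [MOD p] then 1 else 0 := by
  have key : ∀ r ∈ hitResidues i j p,
      (if m ≡ r [MOD p] then (1 : ℝ) else 0) = if m % p = r then 1 else 0 := by
    intro r hr
    have hr' : r < p := Finset.mem_range.mp (Finset.mem_filter.mp hr).1
    have : m ≡ r [MOD p] ↔ m % p = r := by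
      unfold Nat.ModEq; rw [Nat.mod_eq_of_lt hr']
    simp only [this]
  rw [Finset.sum_congr rfl key, Finset.sum_ite_eq]
  have h (i : ℕ) : p ∣ m % p + i ↔ p ∣ m + i := by
    conv_rhs => rw [← Nat.div_add_mod m p, add_assoc]
    exact (Nat.dvd_add_right (Dvd.intro _ rfl)).symm
  simp only [hit, hitResidues, Finset.mem_filter, Finset.mem_range, Nat.mod_lt m hp, true_and, h]

/-- The auxiliary class `c` modulo `d` makes the induction work: the Chinese remainder theorem
absorbs one prime at a time into the modulus. In the end there are `∏ nu` classes, each counted with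
an error of at most 1. -/
theorem abs_sum_modEq_prod_hit_sub_le (X i j : ℕ) (S : Finset ℕ) (hS : ∀ p ∈ S, p.Prime) (c : ℕ)
    {d : ℕ} (hd : 0 < d) (hdS : ∀ p ∈ S, d.Coprime p) :
    |∑ m ∈ Finset.range X, (if m ≡ c [MOD d] then (1 : ℝ) else 0) * ∏ p ∈ S, hit i j m p -
        X / d * ∏ p ∈ S, (nu i j p / p : ℝ)| ≤ ∏ p ∈ S, (nu i j p : ℝ) := by
  induction S using Finset.induction_on generalizing c d with
  | empty => simpa using abs_sum_modEq_sub_le X c hd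
  | insert q S hq ih =>
    have hqp : q.Prime := hS q (Finset.mem_insert_self q S)
    have hdq : d.Coprime q := hdS q (Finset.mem_insert_self q S)
    have hSp : ∀ p ∈ S, p.Prime := fun p hp => hS p (Finset.mem_insert_of_mem hp)
    have hdqS : ∀ p ∈ S, (d * q).Coprime p := fun p hp =>
      (hdS p (Finset.mem_insert_of_mem hp)).mul_left
        ((Nat.coprime_primes hqp (hSp p hp)).mpr (by rintro rfl; exact hq hp))
    have e1 : ∑ m ∈ Finset.range X, (if m ≡ c [MOD d] then (1 : ℝ) else 0) *
        ∏ p ∈ insert q S, hit i j m p = ∑ r ∈ hitResidues i j q, ∑ m ∈ Finset.range X,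
        (if m ≡ (Nat.chineseRemainder hdq c r : ℕ) [MOD d * q] then (1 : ℝ) else 0) *
          ∏ p ∈ S, hit i j m p := by
      rw [Finset.sum_comm]
      refine Finset.sum_congr rfl fun m _ => ?_
      rw [Finset.prod_insert hq, hit_eq_sum i j m hqp.pos, ← Finset.sum_mul, ← mul_assoc,
        Finset.mul_sum]
      congr 1
      refine Finset.sum_congr rfl fun r _ => ?_
      have hcr := (Nat.chineseRemainder hdq c r).2
      have : m ≡ (Nat.chineseRemainder hdq c r : ℕ) [MOD d * q] ↔
          m ≡ c [MOD d] ∧ m ≡ r [MOD q] := by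
        rw [← Nat.modEq_and_modEq_iff_modEq_mul hdq]
        exact ⟨fun h => ⟨h.1.trans hcr.1, h.2.trans hcr.2⟩,
          fun h => ⟨h.1.trans hcr.1.symm, h.2.trans hcr.2.symm⟩⟩
      simp only [this]
      by_cases h1 : m ≡ c [MOD d] <;> by_cases h2 : m ≡ r [MOD q] <;> simp [h1, h2]
    have hq0 : (q : ℝ) ≠ 0 := by exact_mod_cast hqp.ne_zero
    have hd0 : (d : ℝ) ≠ 0 := by exact_mod_cast hd.ne'
    have e2 : (X : ℝ) / d * ∏ p ∈ insert q S, (nu i j p / p : ℝ) =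
        ∑ r ∈ hitResidues i j q, (X : ℝ) / (d * q : ℕ) * ∏ p ∈ S, (nu i j p / p : ℝ) := by
      rw [Finset.sum_const, card_hitResidues i j hqp.pos, Finset.prod_insert hq, nsmul_eq_mul]
      push_cast
      field_simp
    rw [e1, e2, ← Finset.sum_sub_distrib, Finset.prod_insert hq,
      ← card_hitResidues i j hqp.pos, ← nsmul_eq_mul]
    exact (Finset.abs_sum_le_sum_abs _ _).trans (Finset.sum_le_card_nsmul _ _ _ fun r _ =>
      ih hSp _ (Nat.mul_pos hd hqp.pos) hdqS)

theorem nu_le_two (i j p : ℕ) : (nu i j p : ℝ) ≤ 2 := by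
  unfold nu; split_ifs <;> norm_num

theorem one_le_nu (i j p : ℕ) : (1 : ℝ) ≤ nu i j p := by
  unfold nu; split_ifs <;> norm_num

theorem abs_sum_prod_hit_sub_le (X i j : ℕ) (S : Finset ℕ) (hS : ∀ p ∈ S, p.Prime) :
    |∑ m ∈ Finset.range X, ∏ p ∈ S, hit i j m p - X * ∏ p ∈ S, (nu i j p / p : ℝ)| ≤
      2 ^ S.card := by
  have h := abs_sum_modEq_prod_hit_sub_le X i j S hS 0 one_pos fun p _ => Nat.coprime_one_left p
  simp only [Nat.modEq_one, if_true, one_mul, Nat.cast_one, div_one] at h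
  refine h.trans ?_
  rw [← Finset.prod_const]
  exact Finset.prod_le_prod (fun p _ => by positivity) fun p _ => nu_le_two i j p

/-! ### The Brun-Hooley sieve -/

theorem weightedSum_mono {c c' : ℕ → ℝ} (h : ∀ i, c i ≤ c' i) (s : Finset ℕ) {x : ℕ → ℝ}
    (hx : ∀ p ∈ s, 0 ≤ x p) : weightedSum c s x ≤ weightedSum c' s x :=
  Finset.sum_le_sum fun _ hS => mul_le_mul_of_nonneg_right (h _)
    (Finset.prod_nonneg fun p hp => hx p (Finset.mem_powerset.mp hS hp))

theorem weightedSum_nonneg {c : ℕ → ℝ} (h : ∀ i, 0 ≤ c i) (s : Finset ℕ) {x : ℕ → ℝ}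
    (hx : ∀ p ∈ s, 0 ≤ x p) : 0 ≤ weightedSum c s x :=
  Finset.sum_nonneg fun _ hS => mul_nonneg (h _)
    (Finset.prod_nonneg fun p hp => hx p (Finset.mem_powerset.mp hS hp))

/-- The indicator function of `i ≤ k`. -/
def truncCoef (k i : ℕ) : ℝ := if i ≤ k then 1 else 0

theorem truncCoef_nonneg (k i : ℕ) : 0 ≤ truncCoef k i := by
  unfold truncCoef; split_ifs <;> norm_num

/-- The cutoff `k + 1` instead of `k` lets a single remainder `R` serve both the truncated sums and
the symmetric functions of degree `k + 1`. -/
theorem abs_brunCoef_le (k i : ℕ) : |brunCoef k i| ≤ truncCoef (k + 1) i := by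
  unfold brunCoef truncCoef
  split_ifs with h1 h2 h2
  · simp
  · omega
  · simp
  · simp

theorem abs_esymmCoef_le (k i : ℕ) : |esymmCoef k i| ≤ truncCoef k i := by
  unfold esymmCoef truncCoef
  split_ifs with h1 h2 h2
  · simp
  · omega
  · simp
  · simp

theorem hit_nonneg (i j m p : ℕ) : 0 ≤ hit i j m p := by
  unfold hit; split_ifs <;> norm_num

theorem hit_le_one (i j m p : ℕ) : hit i j m p ≤ 1 := by
  unfold hit; split_ifs <;> norm_num

theorem nu_div_nonneg (i j p : ℕ) : (0 : ℝ) ≤ nu i j p / p := by positivity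

theorem nu_div_le_one (i j : ℕ) {p : ℕ} (hp : p.Prime) : (nu i j p / p : ℝ) ≤ 1 := by
  have h2 : (2 : ℝ) ≤ p := by exact_mod_cast hp.two_le
  rw [div_le_one (by linarith)]
  exact (nu_le_two i j p).trans h2

/-- A Brun-Hooley sieve for `(m + i) * (m + j)` with the sifting primes split into blocks `s l`,
where block `l` is truncated after `k l` prime factors. -/
theorem brun_hooley {J : ℕ} (s : Fin J → Finset ℕ)
    (hs : Pairwise fun a b => Disjoint (s a) (s b)) (hsp : ∀ l, ∀ p ∈ s l, p.Prime)
    (k : Fin J → ℕ) (hk : ∀ l, Even (k l)) (X i j : ℕ) (θ : Fin J → ℝ) (R : ℝ)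
    (hθ0 : ∀ l, 0 ≤ θ l)
    (hθ : ∀ l, weightedSum (esymmCoef (k l + 1)) (s l) (fun p => nu i j p / p) ≤
      θ l * ∏ p ∈ s l, (1 - nu i j p / p : ℝ))
    (hR : ∏ l, weightedSum (truncCoef (k l + 1)) (s l) (fun _ => 2) ≤ R) :
    |∑ m ∈ Finset.range X, ∏ l, ∏ p ∈ s l, (1 - hit i j m p) -
        X * ∏ l, ∏ p ∈ s l, (1 - nu i j p / p : ℝ)| ≤
      (J + 1) * R + 2 * X * (∏ l, ∏ p ∈ s l, (1 - nu i j p / p : ℝ)) *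
        ((∑ l, θ l) * Real.exp (∑ l, θ l)) := by
  set ρ : ℕ → ℝ := fun p => nu i j p / p with hρ
  have hρ0 : ∀ l, ∀ p ∈ s l, 0 ≤ ρ p := fun l p _ => nu_div_nonneg i j p
  have hρ1 : ∀ l, ∀ p ∈ s l, ρ p ≤ 1 := fun l p hp => nu_div_le_one i j (hsp l p hp)
  -- One remainder bound for every choice of coefficients; it is applied once to the truncated sums
  -- and once for each block `l` in which a symmetric function replaces the sum.
  have mean : ∀ c : Fin J → ℕ → ℝ, (∀ l i, |c l i| ≤ truncCoef (k l + 1) i) →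
      |∑ m ∈ Finset.range X, ∏ l, weightedSum (c l) (s l) (hit i j m) -
        X * ∏ l, weightedSum (c l) (s l) ρ| ≤ R := by
    intro c hc
    refine (abs_sum_prod_weightedSum_sub_le c s hs X (fun m => hit i j m) ρ 2 ?_).trans
      (le_trans ?_ hR)
    · intro S hS
      refine abs_sum_prod_hit_sub_le X i j S fun p hp => ?_
      obtain ⟨l, hl⟩ := hS p hp
      exact hsp l p hl
    · exact Finset.prod_le_prod
        (fun l _ => weightedSum_nonneg (fun _ => abs_nonneg _) _ fun _ _ => by norm_num)
        fun l _ => weightedSum_mono (hc l) _ fun _ _ => by norm_num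
  set a : Fin J → ℝ := fun l => ∏ p ∈ s l, (1 - ρ p) with ha
  set b : Fin J → ℝ := fun l => weightedSum (brunCoef (k l)) (s l) ρ with hb
  set e : Fin J → ℝ := fun l => weightedSum (esymmCoef (k l + 1)) (s l) ρ with he
  have ha0 : ∀ l, 0 ≤ a l := fun l => Finset.prod_nonneg fun p hp => by linarith [hρ1 l p hp]
  have hab : ∀ l, a l ≤ b l := fun l => prod_le_weightedSum_brunCoef (hk l) _ (hρ0 l) (hρ1 l)
  have hbe : ∀ l, b l - a l ≤ e l := fun l =>
    weightedSum_brunCoef_sub_prod_le (hk l) _ (hρ0 l) (hρ1 l)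
  -- the main terms
  have hterm : ∀ l, ∏ t, (if t = l then e t else b t) ≤ θ l * ((∏ t, a t) *
      Real.exp (∑ l, θ l)) := by
    intro l
    have h1 : ∏ t, (if t = l then e t else b t) ≤
        ∏ t, ((if t = l then θ t else 1) * (a t * Real.exp (θ t))) := by
      refine Finset.prod_le_prod (fun t _ => ?_) fun t _ => ?_
      · split_ifs
        · exact weightedSum_esymmCoef_nonneg _ _ (hρ0 t)
        · exact (ha0 t).trans (hab t)
      · have hexp : 1 + θ t ≤ Real.exp (θ t) := by linarith [Real.add_one_le_exp (θ t)]
        have hexp1 : 1 ≤ Real.exp (θ t) := by linarith [hθ0 t]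
        split_ifs
        · refine (hθ t).trans (mul_le_mul_of_nonneg_left ?_ (hθ0 t))
          exact le_mul_of_one_le_right (ha0 t) hexp1
        · rw [one_mul]
          have : b t ≤ a t * (1 + θ t) := by linarith [hbe t, hθ t]
          exact this.trans (mul_le_mul_of_nonneg_left hexp (ha0 t))
    refine h1.trans (le_of_eq ?_)
    rw [Finset.prod_mul_distrib, Finset.prod_ite_eq' Finset.univ l θ, if_pos (Finset.mem_univ l),
      Finset.prod_mul_distrib, Real.exp_sum]
  have hsum : ∑ l, ∏ t, (if t = l then e t else b t) ≤
      (∏ t, a t) * ((∑ l, θ l) * Real.exp (∑ l, θ l)) := by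
    refine (Finset.sum_le_sum fun l _ => hterm l).trans (le_of_eq ?_)
    rw [← Finset.sum_mul]; ring
  have hba : ∏ t, b t - ∏ t, a t ≤ ∑ l, ∏ t, (if t = l then e t else b t) :=
    prod_sub_prod_le_sum_prod _ (fun t _ => ha0 t) (fun t _ => hab t) fun t _ => hbe t
  have hba0 : ∏ t, a t ≤ ∏ t, b t := Finset.prod_le_prod (fun t _ => ha0 t) fun t _ => hab t
  -- pointwise bounds
  have hh0 : ∀ m l, ∀ p ∈ s l, 0 ≤ hit i j m p := fun m l p _ => hit_nonneg i j m p
  have hh1 : ∀ m l, ∀ p ∈ s l, hit i j m p ≤ 1 := fun m l p _ => hit_le_one i j m p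
  have up : ∀ m, ∏ l, ∏ p ∈ s l, (1 - hit i j m p) ≤
      ∏ l, weightedSum (brunCoef (k l)) (s l) (hit i j m) := fun m =>
    Finset.prod_le_prod (fun l _ => Finset.prod_nonneg fun p hp => by linarith [hh1 m l p hp])
      fun l _ => prod_le_weightedSum_brunCoef (hk l) _ (hh0 m l) (hh1 m l)
  -- Truncating all blocks at even levels only yields an upper bound for the indicator; Hooley's
  -- inequality turns the same truncations into a lower bound.
  have low : ∀ m, ∏ l, weightedSum (brunCoef (k l)) (s l) (hit i j m) -
      ∏ l, ∏ p ∈ s l, (1 - hit i j m p) ≤ ∑ l, ∏ t, weightedSum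
        (if t = l then esymmCoef (k t + 1) else brunCoef (k t)) (s t) (hit i j m) := by
    intro m
    refine (prod_sub_prod_le_sum_prod (w := fun t =>
      weightedSum (esymmCoef (k t + 1)) (s t) (hit i j m)) _
      (fun l _ => Finset.prod_nonneg fun p hp => by linarith [hh1 m l p hp])
      (fun l _ => prod_le_weightedSum_brunCoef (hk l) _ (hh0 m l) (hh1 m l))
      (fun l _ => weightedSum_brunCoef_sub_prod_le (hk l) _ (hh0 m l) (hh1 m l))).trans
      (le_of_eq ?_)
    refine Finset.sum_congr rfl fun l _ => Finset.prod_congr rfl fun t _ => ?_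
    split_ifs <;> rfl
  have m0 := mean (fun l => brunCoef (k l)) fun l i => abs_brunCoef_le _ _
  have m1 : ∀ l, |∑ m ∈ Finset.range X, ∏ t, weightedSum
      (if t = l then esymmCoef (k t + 1) else brunCoef (k t)) (s t) (hit i j m) -
      X * ∏ t, (if t = l then e t else b t)| ≤ R := by
    intro l
    have := mean (fun t => if t = l then esymmCoef (k t + 1) else brunCoef (k t)) fun t i => by
      split_ifs
      · exact abs_esymmCoef_le _ _
      · exact abs_brunCoef_le _ _
    have e1 : ∏ t, (if t = l then e t else b t) = ∏ t, weightedSum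
        (if t = l then esymmCoef (k t + 1) else brunCoef (k t)) (s t) ρ :=
      Finset.prod_congr rfl fun t _ => by split_ifs <;> rfl
    rw [e1]; exact this
  have s0 := Finset.sum_le_sum fun m (_ : m ∈ Finset.range X) => up m
  have s1 := Finset.sum_le_sum fun m (_ : m ∈ Finset.range X) => low m
  rw [Finset.sum_sub_distrib, Finset.sum_comm] at s1
  have s2 : ∑ l, ∑ m ∈ Finset.range X, ∏ t, weightedSum
      (if t = l then esymmCoef (k t + 1) else brunCoef (k t)) (s t) (hit i j m) ≤
      ∑ l : Fin J, (X * ∏ t, (if t = l then e t else b t) + R) :=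
    Finset.sum_le_sum fun l _ => by linarith [(abs_le.mp (m1 l)).2]
  rw [Finset.sum_add_distrib, ← Finset.mul_sum, Finset.sum_const, Finset.card_univ,
    Fintype.card_fin, nsmul_eq_mul] at s2
  have hX : (0 : ℝ) ≤ X := Nat.cast_nonneg X
  obtain ⟨m01, m02⟩ := abs_le.mp m0
  have t1 := mul_le_mul_of_nonneg_left hsum hX
  have t2 := mul_le_mul_of_nonneg_left hba hX
  have t3 := mul_le_mul_of_nonneg_left hba0 hX
  have hR0 : 0 ≤ R := (abs_nonneg _).trans m0
  have hJR : 0 ≤ (J : ℝ) * R := by positivity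
  have hb' : ∏ l, weightedSum (brunCoef (k l)) (s l) ρ = ∏ t, b t := rfl
  have ha' : ∏ l, ∏ p ∈ s l, (1 - ρ p) = ∏ t, a t := rfl
  simp only [hb', ha'] at *
  have t0 := t3.trans (le_of_eq rfl)
  -- The upper bound uses `mean` once, the lower bound `J + 1` times; hence the factor `J + 1`.
  rw [abs_le]
  constructor <;> nlinarith

/-! ### Sums of reciprocals of primes -/

theorem sum_Ico_inv_le {r n : ℕ} (hr : 0 < r) (hrn : r ≤ n) :
    ∑ i ∈ Finset.Ico r (n + 1), (1 / i : ℝ) ≤ 1 + Real.log (n / r) := by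
  have hr' : (0 : ℝ) < r := by exact_mod_cast hr
  induction n, hrn using Nat.le_induction with
  | base =>
    have : (1 : ℝ) ≤ r := by exact_mod_cast hr
    simp only [Nat.Ico_succ_singleton, Finset.sum_singleton, div_self hr'.ne', Real.log_one,
      add_zero]
    exact div_le_one_of_le₀ this hr'.le
  | succ n hn ih =>
    rw [Finset.sum_Ico_succ_top (by omega)]
    have hn' : (0 : ℝ) < n := by exact_mod_cast (by omega : 0 < n)
    have h := Real.one_sub_inv_le_log_of_pos (x := (n + 1) / n) (by positivity)
    have e1 : 1 - ((n + 1 : ℝ) / n)⁻¹ = 1 / (n + 1) := by field_simp; ring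
    have e2 : Real.log ((n + 1 : ℝ) / r) = Real.log (n / r) + Real.log ((n + 1) / n) := by
      rw [← Real.log_mul (by positivity) (by positivity)]
      congr 1; field_simp
    push_cast
    rw [e2]
    linarith

/-- Chebyshev's argument: the product of these primes divides a primorial, and `primorial n ≤ 4 ^ n`
limits their number to `4 * 2 ^ i / i`. -/
theorem sum_inv_primes_dyadic_le {i : ℕ} (hi : 0 < i) (s : Finset ℕ)
    (hs : ∀ p ∈ s, p.Prime ∧ 2 ^ i ≤ p ∧ p < 2 ^ (i + 1)) : ∑ p ∈ s, (1 / p : ℝ) ≤ 4 * (1 / i) := by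
  have h1 : (2 ^ i) ^ s.card ≤ primorial (2 ^ (i + 1)) := by
    calc (2 ^ i) ^ s.card = ∏ _p ∈ s, 2 ^ i := by rw [Finset.prod_const]
      _ ≤ ∏ p ∈ s, p := Finset.prod_le_prod' fun p hp => (hs p hp).2.1
      _ ≤ primorial (2 ^ (i + 1)) := by
        refine Finset.prod_le_prod_of_subset_of_one_le' (fun p hp => ?_) fun p hp _ => ?_
        · simp only [Finset.mem_filter, Finset.mem_range]
          exact ⟨by have := (hs p hp).2.2; omega, (hs p hp).1⟩
        · exact (Finset.mem_filter.mp hp).2.one_lt.le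
  have h2 := h1.trans (primorial_le_four_pow _)
  rw [← pow_mul, (by norm_num : 4 = 2 ^ 2), ← pow_mul] at h2
  have h3 := (Nat.pow_le_pow_iff_right (by norm_num)).mp h2
  have h4 : (i : ℝ) * s.card ≤ 4 * 2 ^ i := by
    have : (i * s.card : ℕ) ≤ 4 * 2 ^ i := by rw [pow_succ] at h3; omega
    exact_mod_cast this
  have hi' : (0 : ℝ) < i := by exact_mod_cast hi
  calc ∑ p ∈ s, (1 / p : ℝ) ≤ ∑ _p ∈ s, (1 / 2 ^ i : ℝ) := by
        refine Finset.sum_le_sum fun p hp => ?_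
        have : (2 ^ i : ℝ) ≤ p := by exact_mod_cast (hs p hp).2.1
        gcongr
    _ = s.card / 2 ^ i := by rw [Finset.sum_const, nsmul_eq_mul]; ring
    _ ≤ 4 * (1 / i) := by
        rw [mul_one_div, div_le_div_iff₀ (by positivity) hi']
        linarith

/-- A crude form of Mertens' theorem: the sum of `1 / p` over primes in an interval `[z, z ^ T)`
is `O(1 + log T)`. -/
theorem sum_inv_primes_le {T : ℕ} (hT : 0 < T) (s : Finset ℕ) (hs : ∀ p ∈ s, p.Prime)
    (hsT : ∀ p ∈ s, ∀ q ∈ s, q < p ^ T) : ∑ p ∈ s, (1 / p : ℝ) ≤ 8 * (1 + Real.log T) := by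
  have hT' : (1 : ℝ) ≤ T := by exact_mod_cast hT
  have hlogT := Real.log_nonneg hT'
  rcases s.eq_empty_or_nonempty with rfl | hne
  · simp; positivity
  -- The binary logarithms of all elements lie in `[r, (r + 1) * T)`, with `r` that of the least
  -- one, so the sum of `1 / i` over this range depends on `T` alone.
  set p₀ := s.min' hne with hp₀
  have hp₀s : p₀ ∈ s := s.min'_mem hne
  set r := Nat.log 2 p₀ with hr
  have hr0 : 0 < r := Nat.log_pos (by norm_num) (hs _ hp₀s).two_le
  have hp₀r : p₀ < 2 ^ (r + 1) := Nat.lt_pow_succ_log_self (by norm_num) _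
  have hmaps : ∀ q ∈ s, Nat.log 2 q ∈ Finset.Ico r ((r + 1) * T) := by
    intro q hq
    rw [Finset.mem_Ico]
    constructor
    · exact Nat.log_mono_right (s.min'_le q hq)
    · refine Nat.log_lt_of_lt_pow (hs q hq).ne_zero ?_
      refine (hsT _ hp₀s q hq).trans_le ?_
      rw [pow_mul]
      exact Nat.pow_le_pow_left hp₀r.le T
  rw [← Finset.sum_fiberwise_of_maps_to hmaps]
  have h1 : ∑ i ∈ Finset.Ico r ((r + 1) * T), ∑ p ∈ s with Nat.log 2 p = i, (1 / p : ℝ) ≤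
      ∑ i ∈ Finset.Ico r ((r + 1) * T), 4 * (1 / i : ℝ) := by
    refine Finset.sum_le_sum fun i hi => sum_inv_primes_dyadic_le
      (hr0.trans_le (Finset.mem_Ico.mp hi).1) _ fun p hp => ?_
    obtain ⟨hps, hpi⟩ := Finset.mem_filter.mp hp
    exact ⟨hs p hps, hpi ▸ Nat.pow_log_le_self 2 (hs p hps).ne_zero,
      hpi ▸ Nat.lt_pow_succ_log_self (by norm_num) p⟩
  refine h1.trans ?_
  rw [← Finset.mul_sum]
  have hrT : r + 1 ≤ (r + 1) * T := Nat.le_mul_of_pos_right _ hT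
  obtain ⟨n, hn⟩ : ∃ n, (r + 1) * T = n + 1 := ⟨(r + 1) * T - 1, by omega⟩
  rw [hn]
  have h2 := sum_Ico_inv_le (n := n) hr0 (by omega)
  have hr' : (1 : ℝ) ≤ r := by exact_mod_cast hr0
  have hn0 : (0 : ℝ) < n := by exact_mod_cast (by omega : 0 < n)
  have hnT : (n : ℝ) / r ≤ 2 * T := by
    rw [div_le_iff₀ (by linarith)]
    have : (n : ℝ) + 1 = (r + 1) * T := by exact_mod_cast hn.symm
    nlinarith
  have h3 : Real.log (n / r) ≤ Real.log 2 + Real.log T := by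
    rw [← Real.log_mul (by norm_num) (by positivity)]
    exact Real.log_le_log (by positivity) hnT
  have := Real.log_two_lt_d9
  linarith

/-- By `log x ≥ 1 - 1 / x` the logarithm of the right side is at least `-2 / (p - 2)`, and `2 / (p -
2) ≤ 6 / p` is an equality at `p = 3`. -/
theorem exp_neg_le_one_sub_two_div {p : ℕ} (hp : 3 ≤ p) :
    Real.exp (-(6 * (1 / p : ℝ))) ≤ 1 - 2 / p := by
  have hp' : (3 : ℝ) ≤ p := by exact_mod_cast hp
  have hpos : (0 : ℝ) < 1 - 2 / p := by
    rw [sub_pos, div_lt_one (by linarith)]; linarith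
  rw [← Real.le_log_iff_exp_le hpos]
  refine le_trans ?_ (Real.one_sub_inv_le_log_of_pos hpos)
  have e : 1 - (1 - 2 / (p : ℝ))⁻¹ = -(2 / (p - 2)) := by
    have h1 : (p : ℝ) - 2 ≠ 0 := by linarith
    have h2 : (p : ℝ) ≠ 0 := by linarith
    have h3 : 1 - 2 / (p : ℝ) = (p - 2) / p := by field_simp
    rw [h3, inv_div]
    field_simp; ring
  rw [e, neg_le_neg_iff, mul_one_div, div_le_div_iff₀ (by linarith) (by linarith)]
  linarith

/-- Equal parity is needed at `p = 2` only: the factor there is `1 / 2`, whereas it vanishes for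
opposite parity. -/
theorem exp_neg_le_one_sub_nu_div {i j p : ℕ} (hij : i ≡ j [MOD 2]) (hp : p.Prime) :
    Real.exp (-(6 * (1 / p : ℝ))) ≤ 1 - nu i j p / p := by
  rcases hp.two_le.eq_or_lt with rfl | h3
  · have h2 : (1 : ℝ) - (nu i j 2 : ℕ) / (2 : ℕ) = 1 / 2 := by
      simp only [nu, hij, if_true]; norm_num
    rw [h2, ← Real.le_log_iff_exp_le (by norm_num)]
    refine le_trans ?_ (Real.one_sub_inv_le_log_of_pos (by norm_num))
    norm_num
  · refine (exp_neg_le_one_sub_two_div h3).trans ?_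
    have : (nu i j p : ℝ) / p ≤ 2 / p := by
      have := nu_le_two i j p
      gcongr
    linarith

theorem exp_neg_sum_le_prod {i j : ℕ} (hij : i ≡ j [MOD 2]) (s : Finset ℕ)
    (hs : ∀ p ∈ s, p.Prime) :
    Real.exp (-(6 * ∑ p ∈ s, (1 / p : ℝ))) ≤ ∏ p ∈ s, (1 - nu i j p / p : ℝ) := by
  rw [Finset.mul_sum, ← Finset.sum_neg_distrib, Real.exp_sum]
  exact Finset.prod_le_prod (fun p _ => (Real.exp_pos _).le)
    fun p hp => exp_neg_le_one_sub_nu_div hij (hs p hp)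

/-! ### Blocks of primes -/

/-- A crude bound, sufficient for the blocks of small primes. -/
theorem weightedSum_truncCoef_le_pow (K : ℕ) (s : Finset ℕ) :
    weightedSum (truncCoef K) s (fun _ => 2) ≤ (1 + 2 * s.card : ℝ) ^ K := by
  induction s using Finset.induction_on generalizing K with
  | empty => simp [weightedSum_empty, truncCoef]
  | insert a s ha ih =>
    rw [weightedSum_insert _ ha, Finset.card_insert_of_notMem ha]
    have hA : (0 : ℝ) ≤ 1 + 2 * s.card := by positivity
    rcases K with _ | K
    · have h0 := ih 0
      have : weightedSum (fun i => truncCoef 0 (i + 1)) s (fun _ => 2) = 0 := by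
        simp [weightedSum, truncCoef]
      rw [this]; simpa using h0
    · have : (fun i => truncCoef (K + 1) (i + 1)) = truncCoef K := by
        funext i; simp [truncCoef]
      rw [this]
      have h1 := ih (K + 1)
      have h2 := ih K
      have h3 : (1 + 2 * s.card : ℝ) ^ K ≤ (1 + 2 * (s.card + 1 : ℝ)) ^ K := by
        gcongr; linarith
      push_cast
      rw [pow_succ] at h1 ⊢
      nlinarith

theorem pow_div_factorial_mono {A : ℝ} {i K : ℕ} (hiK : i ≤ K) (hKA : (K : ℝ) ≤ A) :
    A ^ i / i.factorial ≤ A ^ K / K.factorial := by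
  induction K, hiK using Nat.le_induction with
  | base => exact le_rfl
  | succ K hK ih =>
    push_cast at hKA
    refine (ih (by linarith)).trans ?_
    have hA : 0 ≤ A := by
      have : (0 : ℝ) ≤ K := Nat.cast_nonneg K
      linarith
    rw [Nat.factorial_succ, pow_succ]
    push_cast
    rw [div_le_div_iff₀ (by positivity) (by positivity)]
    have : 0 ≤ A ^ K * K.factorial := by positivity
    nlinarith

/-- Meant for the block of the largest primes, where the factor `1 / K!` has to be kept: the
remainder must come out below `sieveSaving k`, which itself contains `1 / (k + 1)!`. -/
theorem weightedSum_truncCoef_le {K y : ℕ} (s : Finset ℕ) (hs : s.card ≤ y) (hK : K ≤ 2 * y) :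
    weightedSum (truncCoef K) s (fun _ => 2) ≤
      (K + 1) * ((2 * y : ℝ) ^ K / K.factorial) := by
  have e : weightedSum (truncCoef K) s (fun _ => 2) =
      ∑ i ∈ Finset.range (K + 1), weightedSum (esymmCoef i) s (fun _ => 2) := by
    unfold weightedSum
    rw [Finset.sum_comm]
    refine Finset.sum_congr rfl fun S _ => ?_
    rw [← Finset.sum_mul]
    simp [esymmCoef, truncCoef]
  rw [e]
  have hb : ∀ i ∈ Finset.range (K + 1), weightedSum (esymmCoef i) s (fun _ => 2) ≤
      (2 * y : ℝ) ^ K / K.factorial := by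
    intro i hi
    refine (weightedSum_esymmCoef_le i s fun _ _ => by norm_num).trans ?_
    refine le_trans ?_ (pow_div_factorial_mono (A := 2 * y)
      (Nat.lt_succ_iff.mp (Finset.mem_range.mp hi)) (by exact_mod_cast hK))
    rw [Finset.sum_const, nsmul_eq_mul, mul_comm (s.card : ℝ)]
    have : (s.card : ℝ) ≤ y := by exact_mod_cast hs
    gcongr
  refine (Finset.sum_le_card_nsmul _ _ _ hb).trans (le_of_eq ?_)
  rw [Finset.card_range, nsmul_eq_mul]
  push_cast; ring

/-- The primes up to `y`. -/
def primesUpTo (y : ℕ) : Finset ℕ := (Finset.Icc 1 y).filter Nat.Prime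

theorem mem_primesUpTo {y p : ℕ} : p ∈ primesUpTo y ↔ p.Prime ∧ p ≤ y := by
  simp only [primesUpTo, Finset.mem_filter, Finset.mem_Icc]
  exact ⟨fun h => ⟨h.2, h.1.2⟩, fun h => ⟨⟨h.1.one_lt.le, h.2⟩, h.1⟩⟩

/-- The primes `p ≤ y` with `T ^ l ≤ log y / log p < T ^ (l + 1)`. -/
def primeBlock (T y l : ℕ) : Finset ℕ :=
  {p ∈ primesUpTo y | Nat.log T (Nat.log p y) = l}

theorem mem_primeBlock {T y l p : ℕ} (hT : 1 < T) (hp : p ∈ primeBlock T y l) :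
    p.Prime ∧ p ≤ y ∧ p ^ T ^ l ≤ y ∧ y < p ^ T ^ (l + 1) := by
  obtain ⟨h1, h2⟩ := Finset.mem_filter.mp hp
  obtain ⟨hpp, hpy⟩ := mem_primesUpTo.mp h1
  have hl : Nat.log p y ≠ 0 := (Nat.log_pos hpp.one_lt hpy).ne'
  have hy : y ≠ 0 := by have := hpp.pos; omega
  refine ⟨hpp, hpy, ?_, ?_⟩
  · exact Nat.pow_le_of_le_log hy (h2 ▸ Nat.pow_log_le_self T hl)
  · exact Nat.lt_pow_of_log_lt hpp.one_lt (h2 ▸ Nat.lt_pow_succ_log_self hT _)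

theorem disjoint_primeBlock (T y : ℕ) {a b : ℕ} (hab : a ≠ b) :
    Disjoint (primeBlock T y a) (primeBlock T y b) := by
  rw [Finset.disjoint_left]
  intro p ha hb
  exact hab ((Finset.mem_filter.mp ha).2.symm.trans (Finset.mem_filter.mp hb).2)

/-- The block index is an iterated logarithm of `y`, hence below `y`. Using `y` blocks is wasteful
but costs only the factor `y + 1` in the remainder. -/
theorem prod_primeBlock (T y : ℕ) (f : ℕ → ℝ) :
    ∏ l : Fin y, ∏ p ∈ primeBlock T y l, f p = ∏ p ∈ primesUpTo y, f p := by
  rw [← Finset.prod_range (fun l => ∏ p ∈ primeBlock T y l, f p)]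
  refine Finset.prod_fiberwise_of_maps_to (fun p hp => ?_) f
  obtain ⟨hpp, hpy⟩ := mem_primesUpTo.mp hp
  have hy : y ≠ 0 := by have := hpp.pos; omega
  rw [Finset.mem_range]
  exact (Nat.log_le_self _ _).trans_lt (Nat.log_lt_self _ hy)

/-- For `p`, `q` in the block, `q ^ T ^ l ≤ y < p ^ T ^ (l + 1)`, so `q < p ^ T`. -/
theorem sum_inv_primeBlock_le {T : ℕ} (hT : 1 < T) (y l : ℕ) :
    ∑ p ∈ primeBlock T y l, (1 / p : ℝ) ≤ 8 * (1 + Real.log T) := by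
  refine sum_inv_primes_le (by omega) _ (fun p hp => (mem_primeBlock hT hp).1) ?_
  intro p hp q hq
  have h1 := (mem_primeBlock hT hp).2.2.2
  have h2 := (mem_primeBlock hT hq).2.2.1
  rw [pow_succ, mul_comm, pow_mul] at h1
  exact lt_of_pow_lt_pow_left₀ (T ^ l) (Nat.zero_le _) (h2.trans_lt h1)

/-- Extract the term `l = 0` by means of `a! * b! ≤ (a + b)!`. The remaining exponents `k * (2 ^ l -
1)` are distinct, so what is left is part of the exponential series. -/
theorem sum_pow_div_factorial_le {Λ : ℝ} (hΛ : 0 ≤ Λ) {k : ℕ} (hk : 0 < k) (J : ℕ) :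
    ∑ l : Fin J, Λ ^ (k * 2 ^ (l : ℕ) + 1) / (k * 2 ^ (l : ℕ) + 1).factorial ≤
      Λ ^ (k + 1) / (k + 1).factorial * Real.exp Λ := by
  have hd : ∀ l : ℕ, k * 2 ^ l + 1 = (k + 1) + k * (2 ^ l - 1) := by
    intro l
    have : 1 ≤ 2 ^ l := Nat.one_le_two_pow
    obtain ⟨t, ht⟩ := Nat.exists_eq_add_of_le this
    rw [ht, Nat.add_sub_cancel_left]; ring
  have hinj : Function.Injective fun l : Fin J => k * (2 ^ (l : ℕ) - 1) := by
    intro a b hab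
    have h1 := Nat.eq_of_mul_eq_mul_left hk hab
    have ha : 1 ≤ 2 ^ (a : ℕ) := Nat.one_le_two_pow
    have hb : 1 ≤ 2 ^ (b : ℕ) := Nat.one_le_two_pow
    exact Fin.ext (Nat.pow_right_injective le_rfl (by dsimp only; omega))
  have h1 : ∀ l : Fin J, Λ ^ (k * 2 ^ (l : ℕ) + 1) / (k * 2 ^ (l : ℕ) + 1).factorial ≤
      Λ ^ (k + 1) / (k + 1).factorial *
        (Λ ^ (k * (2 ^ (l : ℕ) - 1)) / (k * (2 ^ (l : ℕ) - 1)).factorial) := by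
    intro l
    rw [hd l, pow_add, div_mul_div_comm]
    have : ((k + 1).factorial : ℝ) * (k * (2 ^ (l : ℕ) - 1)).factorial ≤
        ((k + 1) + k * (2 ^ (l : ℕ) - 1)).factorial := by
      exact_mod_cast Nat.le_of_dvd (Nat.factorial_pos _)
        (Nat.factorial_mul_factorial_dvd_factorial_add _ _)
    gcongr
  refine (Finset.sum_le_sum fun l _ => h1 l).trans ?_
  rw [← Finset.mul_sum]
  refine mul_le_mul_of_nonneg_left ?_ (by positivity)
  rw [← Finset.sum_image (f := fun d => Λ ^ d / (d.factorial : ℝ))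
    (g := fun l : Fin J => k * (2 ^ (l : ℕ) - 1)) (fun a _ b _ h => hinj h)]
  obtain ⟨n, hn⟩ := (Finset.univ.image fun l : Fin J => k * (2 ^ (l : ℕ) - 1)).exists_nat_subset_range
  exact (Finset.sum_le_sum_of_subset_of_nonneg hn fun _ _ _ => by positivity).trans
    (Real.sum_le_exp_of_nonneg hΛ n)

/-- The block has at most `z = y ^ (1 / T ^ l)` primes, and `1 + 2 * z ≤ z ^ 3` for `z ≥ 2`. With `T
= k + 4`, one factor `T` absorbs `k` and the others outweigh the doubling of the truncation level,
so the exponent of `y` is free of `k` and decays geometrically. -/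
theorem weightedSum_truncCoef_primeBlock_le {k y : ℕ} (l : ℕ) (hy : 2 ≤ y) (hl : l ≠ 0) :
    weightedSum (truncCoef (k * 2 ^ l + 1)) (primeBlock (k + 4) y l) (fun _ => 2) ≤
      (y : ℝ) ^ (12 * (1 / 2 : ℝ) ^ l) := by
  have hy1 : (1 : ℝ) ≤ y := by exact_mod_cast (by omega : 1 ≤ y)
  have hy0 : (0 : ℝ) ≤ y := by linarith
  rcases (primeBlock (k + 4) y l).eq_empty_or_nonempty with he | ⟨q, hq⟩
  · rw [he, weightedSum_empty]
    simp only [truncCoef, zero_le, if_true]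
    exact Real.one_le_rpow hy1 (by positivity)
  set T := k + 4 with hT
  have hT1 : 1 < T := by omega
  set z : ℝ := (y : ℝ) ^ (1 / (T : ℝ) ^ l) with hz
  have hTl : (0 : ℝ) < (T : ℝ) ^ l := by positivity
  have hpz : ∀ p ∈ primeBlock T y l, (p : ℝ) ≤ z := by
    intro p hp
    have h := (mem_primeBlock hT1 hp).2.2.1
    have h' : (p : ℝ) ^ (T ^ l) ≤ y := by exact_mod_cast h
    have h2 := Real.rpow_le_rpow (by positivity) h' (by positivity : 0 ≤ 1 / (T : ℝ) ^ l)
    rw [← Real.rpow_natCast, ← Real.rpow_mul (by positivity)] at h2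
    push_cast at h2
    rwa [mul_one_div_cancel hTl.ne', Real.rpow_one] at h2
  have hz2 : 2 ≤ z := by
    have : (2 : ℝ) ≤ q := by exact_mod_cast (mem_primeBlock hT1 hq).1.two_le
    exact this.trans (hpz q hq)
  have hcard : ((primeBlock T y l).card : ℝ) ≤ z := by
    have hsub : primeBlock T y l ⊆ Finset.Icc 1 ⌊z⌋₊ := fun p hp =>
      Finset.mem_Icc.mpr ⟨(mem_primeBlock hT1 hp).1.one_lt.le, Nat.le_floor (hpz p hp)⟩
    have h := Finset.card_le_card hsub
    rw [Nat.card_Icc, Nat.add_sub_cancel] at h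
    exact (Nat.cast_le.mpr h).trans (Nat.floor_le (by linarith))
  refine (weightedSum_truncCoef_le_pow _ _).trans ?_
  have h3 : (1 + 2 * (primeBlock T y l).card : ℝ) ≤ z ^ 3 := by
    nlinarith [mul_nonneg (mul_nonneg (by linarith : 0 ≤ z) (sub_nonneg.mpr hz2))
      (by linarith : 0 ≤ z + 2)]
  have h4 : (1 + 2 * (primeBlock T y l).card : ℝ) ^ (k * 2 ^ l + 1) ≤
      (z ^ 3) ^ (k * 2 ^ l + 1) := by gcongr
  refine h4.trans ?_
  rw [← pow_mul, hz, ← Real.rpow_natCast, ← Real.rpow_mul hy0]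
  refine Real.rpow_le_rpow_of_exponent_le hy1 ?_
  push_cast
  rw [one_div_mul_eq_div, div_le_iff₀ hTl, mul_assoc, ← mul_pow]
  obtain ⟨t, rfl⟩ := Nat.exists_eq_succ_of_ne_zero hl
  have hT' : (T : ℝ) = k + 4 := by rw [hT]; push_cast; ring
  have h5 : (2 : ℝ) ^ t ≤ (1 / 2 * T) ^ t := by
    have hk : (0 : ℝ) ≤ k := Nat.cast_nonneg k
    gcongr
    rw [hT']; linarith
  have h6 : (1 : ℝ) ≤ 2 ^ t := one_le_pow₀ (by norm_num)
  rw [Nat.succ_eq_add_one, pow_succ, pow_succ]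
  have hk : (0 : ℝ) ≤ k := Nat.cast_nonneg k
  have h7 : (2 : ℝ) ^ t * (k + 4) ≤ (1 / 2 * T) ^ t * (k + 4) := by gcongr
  rw [hT'] at h7 ⊢
  nlinarith

/-- The number `16 (1 + log (k + 4))`, which bounds `∑ 2 / p` over blocks of primes. -/
def blockBound (k : ℕ) : ℝ := 16 * (1 + Real.log (k + 4))

/-- The saving in the sieve truncated after `k` prime factors. -/
def sieveSaving (k : ℕ) : ℝ :=
  Real.exp (4 * blockBound k) * (blockBound k ^ (k + 1) / (k + 1).factorial)

theorem sixteen_le_blockBound (k : ℕ) : 16 ≤ blockBound k := by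
  have hk : (0 : ℝ) ≤ k := Nat.cast_nonneg k
  have : 0 ≤ Real.log (k + 4) := Real.log_nonneg (by linarith)
  unfold blockBound; linarith

theorem sieveSaving_nonneg (k : ℕ) : 0 ≤ sieveSaving k := by
  have := sixteen_le_blockBound k
  unfold sieveSaving; positivity

/-- The number of `m < X` for which `(m + i) * (m + j)` has no prime factor up to `y`. -/
theorem abs_sum_prod_one_sub_hit_sub_le {k y : ℕ} (hk0 : 0 < k) (hk : Even k) (hy : 2 ≤ y)
    (hky : k + 1 ≤ 2 * y) (X i j : ℕ) (hij : i ≡ j [MOD 2]) :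
    |∑ m ∈ Finset.range X, ∏ p ∈ primesUpTo y, (1 - hit i j m p) -
        X * ∏ p ∈ primesUpTo y, (1 - nu i j p / p : ℝ)| ≤
      (y + 1) * ((k + 2) * ((2 * y : ℝ) ^ (k + 1) / (k + 1).factorial) * y ^ 24) +
        2 * X * (∏ p ∈ primesUpTo y, (1 - nu i j p / p : ℝ)) *
          (sieveSaving k * Real.exp (sieveSaving k)) := by
  set T := k + 4 with hT
  have hT1 : 1 < T := by omega
  set Λ := blockBound k with hΛ
  have hΛ16 : 16 ≤ Λ := sixteen_le_blockBound k
  have hΛT : Λ = 2 * (8 * (1 + Real.log T)) := by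
    rw [hΛ, blockBound, hT]; push_cast; ring
  set s : Fin y → Finset ℕ := fun l => primeBlock T y l with hs
  -- The factor `exp (3 * Λ)` makes the error relative: the density of a block is at least `exp (-6
  -- * ∑ 1 / p) ≥ exp (-3 * Λ)`.
  set θ : Fin y → ℝ := fun l => Real.exp (3 * Λ) *
    (Λ ^ (k * 2 ^ (l : ℕ) + 1) / (k * 2 ^ (l : ℕ) + 1).factorial) with hθ
  have hsp : ∀ l, ∀ p ∈ s l, p.Prime := fun l p hp => (mem_primeBlock hT1 hp).1
  have hy1 : (1 : ℝ) ≤ y := by exact_mod_cast (by omega : 1 ≤ y)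
  have main := brun_hooley s
    (fun a b hab => disjoint_primeBlock T y fun h => hab (Fin.ext h)) hsp
    (fun l => k * 2 ^ (l : ℕ)) (fun l => hk.mul_right _) X i j θ
    ((k + 2) * ((2 * y : ℝ) ^ (k + 1) / (k + 1).factorial) * y ^ 24)
    (fun l => by positivity) ?_ ?_
  · have hθsum : ∑ l, θ l ≤ sieveSaving k := by
      rw [hθ, ← Finset.mul_sum]
      refine (mul_le_mul_of_nonneg_left (sum_pow_div_factorial_le (by linarith) hk0 y)
        (by positivity)).trans (le_of_eq ?_)
      rw [sieveSaving, ← hΛ, (by ring : 4 * Λ = 3 * Λ + Λ), Real.exp_add]; ring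
    simp only [hs, prod_primeBlock T y] at main
    refine main.trans (add_le_add le_rfl (mul_le_mul_of_nonneg_left ?_ ?_))
    · have h0 : 0 ≤ ∑ l, θ l := Finset.sum_nonneg fun l _ => by positivity
      have := Real.exp_le_exp.mpr hθsum
      have := Real.exp_pos (∑ l, θ l)
      exact mul_le_mul hθsum ‹_› this.le (h0.trans hθsum)
    · refine mul_nonneg (by positivity) (Finset.prod_nonneg fun p hp => ?_)
      linarith [nu_div_le_one i j (mem_primesUpTo.mp hp).1]
  · intro l
    set K := k * 2 ^ (l : ℕ) + 1
    have hsum := sum_inv_primeBlock_le hT1 y (l : ℕ)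
    have h1 : ∑ p ∈ s l, (nu i j p / p : ℝ) ≤ Λ := by
      rw [hΛT]
      refine le_trans ?_ (mul_le_mul_of_nonneg_left hsum (by norm_num))
      rw [Finset.mul_sum]
      refine Finset.sum_le_sum fun p _ => ?_
      have := nu_le_two i j p
      rw [mul_one_div]; gcongr
    have h2 : 1 ≤ Real.exp (3 * Λ) * ∏ p ∈ s l, (1 - nu i j p / p : ℝ) := by
      have h3 := exp_neg_sum_le_prod hij (s l) (hsp l)
      have h4 : Real.exp (-(3 * Λ)) ≤ ∏ p ∈ s l, (1 - nu i j p / p : ℝ) := by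
        refine le_trans (Real.exp_le_exp.mpr ?_) h3
        rw [hΛT]
        have : ∑ p ∈ s l, (1 / p : ℝ) ≤ 8 * (1 + Real.log T) := hsum
        linarith
      have := mul_le_mul_of_nonneg_left h4 (Real.exp_pos (3 * Λ)).le
      rwa [← Real.exp_add, add_neg_cancel, Real.exp_zero] at this
    refine (weightedSum_esymmCoef_le K (s l) fun p _ => nu_div_nonneg i j p).trans ?_
    have h0 : 0 ≤ ∑ p ∈ s l, (nu i j p / p : ℝ) :=
      Finset.sum_nonneg fun p _ => nu_div_nonneg i j p
    have h5 : (∑ p ∈ s l, (nu i j p / p : ℝ)) ^ K / K.factorial ≤ Λ ^ K / K.factorial := by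
      gcongr
    refine h5.trans ?_
    have h6 : (0 : ℝ) ≤ Λ ^ K / K.factorial := by positivity
    calc Λ ^ K / K.factorial ≤ Λ ^ K / K.factorial *
          (Real.exp (3 * Λ) * ∏ p ∈ s l, (1 - nu i j p / p : ℝ)) := le_mul_of_one_le_right h6 h2
      _ = θ l * ∏ p ∈ s l, (1 - nu i j p / p : ℝ) := by rw [hθ]; ring
  -- Block 0 receives the bound with the factorial; the exponents `12 / 2 ^ l` of `y` add up to at
  -- most 24.
  · set R₀ : ℝ := (k + 2) * ((2 * y : ℝ) ^ (k + 1) / (k + 1).factorial) with hR₀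
    have hl : ∀ l : Fin y, weightedSum (truncCoef (k * 2 ^ (l : ℕ) + 1)) (s l) (fun _ => 2) ≤
        (if l = ⟨0, by omega⟩ then R₀ else 1) * (y : ℝ) ^ (12 * (1 / 2 : ℝ) ^ (l : ℕ)) := by
      intro l
      split_ifs with h
      · have h0 : (l : ℕ) = 0 := congrArg Fin.val h
        have hcard : (s l).card ≤ y := by
          have hsub : s l ⊆ Finset.Icc 1 y := fun p hp => Finset.mem_Icc.mpr
            ⟨(hsp l p hp).one_lt.le, (mem_primeBlock hT1 hp).2.1⟩
          simpa using Finset.card_le_card hsub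
        rw [h0, pow_zero, mul_one]
        refine (weightedSum_truncCoef_le (s l) hcard hky).trans ?_
        have e : (((k + 1 : ℕ) : ℝ) + 1) * ((2 * y : ℝ) ^ (k + 1) / (k + 1).factorial) = R₀ := by
          rw [hR₀]; push_cast; ring
        rw [e]
        refine le_mul_of_one_le_right (by positivity) (Real.one_le_rpow hy1 (by positivity))
      · rw [one_mul]
        exact weightedSum_truncCoef_primeBlock_le (l : ℕ) hy fun h0 => h (Fin.ext h0)
    refine (Finset.prod_le_prod (fun l _ => weightedSum_nonneg (truncCoef_nonneg _) _
      fun _ _ => by norm_num) fun l _ => hl l).trans ?_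
    rw [Finset.prod_mul_distrib, Finset.prod_ite_eq' Finset.univ _ fun _ => R₀,
      if_pos (Finset.mem_univ _), ← Real.rpow_sum_of_pos (by linarith)]
    refine mul_le_mul_of_nonneg_left ?_ (by positivity)
    rw [← Real.rpow_natCast]
    refine Real.rpow_le_rpow_of_exponent_le hy1 ?_
    rw [← Finset.mul_sum, ← Finset.sum_range (fun l => (1 / 2 : ℝ) ^ l)]
    have := sum_geometric_two_le y
    push_cast
    linarith

/-! ### The variance as a sum over pairs -/

/-- The number of `m < X` for which `(m + i) * (m + j)` has no prime factor up to `y`. -/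
def pairCount (X i j y : ℕ) : ℝ :=
  ∑ m ∈ Finset.range X, ∏ p ∈ primesUpTo y, (1 - hit i j m p)

/-- The density of the integers counted by `pairCount`. -/
def pairDensity (i j y : ℕ) : ℝ := ∏ p ∈ primesUpTo y, (1 - nu i j p / p : ℝ)

theorem prod_one_sub_hit (i j m y : ℕ) : ∏ p ∈ primesUpTo y, (1 - hit i j m p) =
    roughInd y (m + i) * roughInd y (m + j) := by
  have e : ∀ p ∈ primesUpTo y, 1 - hit i j m p =
      if ¬ (p ∣ m + i ∨ p ∣ m + j) then (1 : ℝ) else 0 := by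
    intro p _
    unfold hit
    by_cases h : p ∣ m + i ∨ p ∣ m + j <;> simp [h]
  rw [Finset.prod_congr rfl e, Finset.prod_ite_zero, Finset.prod_const_one]
  have h : (∀ p ∈ primesUpTo y, ¬ (p ∣ m + i ∨ p ∣ m + j)) ↔
      (∀ p : ℕ, p.Prime → p ∣ m + i → y < p) ∧ (∀ p : ℕ, p.Prime → p ∣ m + j → y < p) := by
    constructor
    · intro h
      constructor <;> intro p hp hd <;> by_contra hy
      · exact h p (mem_primesUpTo.mpr ⟨hp, not_lt.mp hy⟩) (Or.inl hd)
      · exact h p (mem_primesUpTo.mpr ⟨hp, not_lt.mp hy⟩) (Or.inr hd)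
    · rintro ⟨h1, h2⟩ p hp hd
      obtain ⟨hpp, hpy⟩ := mem_primesUpTo.mp hp
      rcases hd with hd | hd
      · exact absurd hpy (not_le.mpr (h1 p hpp hd))
      · exact absurd hpy (not_le.mpr (h2 p hpp hd))
  unfold roughInd
  by_cases h1 : ∀ p : ℕ, p.Prime → p ∣ m + i → y < p
  · by_cases h2 : ∀ p : ℕ, p.Prime → p ∣ m + j → y < p
    · rw [if_pos (h.mpr ⟨h1, h2⟩), if_pos h1, if_pos h2, one_mul]
    · rw [if_neg (fun h0 => h2 (h.mp h0).2), if_neg h2, mul_zero]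
  · rw [if_neg (fun h0 => h1 (h.mp h0).1), if_neg h1, zero_mul]

theorem roughInd_mul_self (y n : ℕ) : roughInd y n * roughInd y n = roughInd y n := by
  unfold roughInd; split_ifs <;> simp

theorem roughCount_of_mem (H y m : ℕ) {x : ℝ} (h0 : (m : ℝ) ≤ x) (h1 : x < m + 1) :
    roughCount H y x = ∑ i ∈ Finset.range H, roughInd y (m + (i + 1)) := by
  have hx : 0 ≤ x := (Nat.cast_nonneg m).trans h0
  have hf : ⌊x⌋₊ = m := (Nat.floor_eq_iff hx).mpr ⟨h0, h1⟩
  rw [roughCount, Nat.floor_add_natCast hx, hf]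
  have : Finset.Ioc m (m + H) = Finset.Ico (m + 1) (m + H + 1) := by
    ext n; simp only [Finset.mem_Ioc, Finset.mem_Ico]; omega
  rw [this, Finset.sum_Ico_eq_sum_range]
  refine Finset.sum_congr (congrArg _ (by omega)) fun i _ => ?_
  congr 1; ring

/-- The count depends only on `⌊x⌋`, so the integrand is constant on each open unit interval between
integers. -/
theorem V_eq_sum (X H y : ℕ) : V X H y = 1 / (X : ℝ) * ∑ m ∈ Finset.range X,
    (∑ i ∈ Finset.range H, roughInd y (m + (i + 1)) - H * roughDensity y) ^ 2 := by
  set F : ℝ → ℝ := fun x => (roughCount H y x - H * roughDensity y) ^ 2 with hF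
  set c : ℕ → ℝ := fun m =>
    (∑ i ∈ Finset.range H, roughInd y (m + (i + 1)) - H * roughDensity y) ^ 2 with hc
  have heq : ∀ m : ℕ, Set.EqOn (fun _ => c m) F (Set.uIoo (m : ℝ) ((m + 1 : ℕ) : ℝ)) := by
    intro m x hx
    have hle : (m : ℝ) ≤ ((m + 1 : ℕ) : ℝ) := by push_cast; linarith
    rw [Set.uIoo_of_le hle] at hx
    obtain ⟨h0, h1⟩ := hx
    push_cast at h1
    simp only [hF, hc, roughCount_of_mem H y m h0.le h1]
  have hint : ∀ m : ℕ, IntervalIntegrable F MeasureTheory.volume (m : ℝ) ((m + 1 : ℕ) : ℝ) := by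
    intro m
    refine (intervalIntegrable_const (c := c m)).congr_uIoo (heq m)
  have hval : ∀ m : ℕ, ∫ x in (m : ℝ)..((m + 1 : ℕ) : ℝ), F x = c m := by
    intro m
    rw [← intervalIntegral.integral_congr_uIoo (heq m), intervalIntegral.integral_const]
    push_cast; simp
  have h := intervalIntegral.sum_integral_adjacent_intervals (f := F)
    (μ := MeasureTheory.volume) (a := fun k : ℕ => (k : ℝ)) (n := X) fun k _ => hint k
  rw [V, ← Nat.cast_zero (R := ℝ), ← h]
  simp only [hval]

/-- The indicator is its own square, so the linear term of the expansion is a sum of diagonal pair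
counts and one sieve estimate covers everything. -/
theorem V_eq_pairCount {X : ℕ} (hX : 0 < X) (H y : ℕ) : V X H y =
    (∑ i ∈ Finset.range H, ∑ j ∈ Finset.range H, pairCount X (i + 1) (j + 1) y / X) -
      2 * (H * roughDensity y) *
        (∑ i ∈ Finset.range H, pairCount X (i + 1) (i + 1) y / X) +
      (H * roughDensity y) ^ 2 := by
  have hX' : (X : ℝ) ≠ 0 := by exact_mod_cast hX.ne'
  have e1 : ∑ m ∈ Finset.range X, (∑ i ∈ Finset.range H, roughInd y (m + (i + 1))) ^ 2 =
      ∑ i ∈ Finset.range H, ∑ j ∈ Finset.range H, pairCount X (i + 1) (j + 1) y := by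
    simp only [pairCount, prod_one_sub_hit, pow_two, Finset.sum_mul_sum]
    rw [Finset.sum_comm]
    exact Finset.sum_congr rfl fun i _ => Finset.sum_comm
  have e2 : ∑ m ∈ Finset.range X, ∑ i ∈ Finset.range H, roughInd y (m + (i + 1)) =
      ∑ i ∈ Finset.range H, pairCount X (i + 1) (i + 1) y := by
    simp only [pairCount, prod_one_sub_hit, roughInd_mul_self]
    exact Finset.sum_comm
  rw [V_eq_sum]
  simp only [sub_sq, Finset.sum_add_distrib, Finset.sum_sub_distrib, ← Finset.sum_mul,
    mul_assoc, ← Finset.mul_sum, Finset.sum_const, Finset.card_range, nsmul_eq_mul, e1, e2,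
    ← Finset.sum_div]
  field_simp

theorem pairDensity_self (i y : ℕ) : pairDensity i i y = roughDensity y := by
  simp only [pairDensity, roughDensity, nu, Nat.ModEq.refl, if_true, Nat.cast_one]
  rfl

theorem roughDensity_nonneg (y : ℕ) : 0 ≤ roughDensity y :=
  Finset.prod_nonneg fun p hp => by
    have : (1 : ℝ) ≤ p := by exact_mod_cast (Finset.mem_filter.mp hp).2.one_lt.le
    rw [sub_nonneg]
    exact div_le_one_of_le₀ this (by positivity)

theorem roughDensity_le_one (y : ℕ) : roughDensity y ≤ 1 :=
  Finset.prod_le_one (fun p hp => by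
    have : (1 : ℝ) ≤ p := by exact_mod_cast (Finset.mem_filter.mp hp).2.one_lt.le
    rw [sub_nonneg]
    exact div_le_one_of_le₀ this (by positivity)) fun p _ => by
      have : (0 : ℝ) ≤ 1 / p := by positivity
      linarith

theorem pairDensity_le (i j y : ℕ) : pairDensity i j y ≤ roughDensity y := by
  refine Finset.prod_le_prod (fun p hp => ?_) fun p _ => ?_
  · linarith [nu_div_le_one i j (mem_primesUpTo.mp hp).1]
  · have := one_le_nu i j p
    gcongr

/-! ### The main term as a full-period variance -/

/-- The odd primes up to `y`. -/
def oddPrimesUpTo (y : ℕ) : Finset ℕ := (Finset.Icc 3 y).filter Nat.Prime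

theorem mem_oddPrimesUpTo {y p : ℕ} : p ∈ oddPrimesUpTo y ↔ p.Prime ∧ 3 ≤ p ∧ p ≤ y := by
  simp only [oddPrimesUpTo, Finset.mem_filter, Finset.mem_Icc]; tauto

theorem primesUpTo_eq_insert {y : ℕ} (hy : 2 ≤ y) :
    primesUpTo y = insert 2 (oddPrimesUpTo y) := by
  ext p
  rw [Finset.mem_insert, mem_primesUpTo, mem_oddPrimesUpTo]
  constructor
  · rintro ⟨hp, h⟩
    rcases hp.two_le.eq_or_lt with h2 | h2
    · exact Or.inl h2.symm
    · exact Or.inr ⟨hp, h2, h⟩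
  · rintro (rfl | h)
    · exact ⟨Nat.prime_two, hy⟩
    · exact ⟨h.1, h.2.2⟩

theorem two_notMem_oddPrimesUpTo (y : ℕ) : 2 ∉ oddPrimesUpTo y := fun h => by
  have := (mem_oddPrimesUpTo.mp h).2.1; omega

/-- With `N = H / q` and `s = H % q`, there are `s` classes of size `N + 1` and `q - s` of size `N`.
In the induction the new element adds `2 * (H / q) + 1` pairs. -/
theorem sum_sum_modEq (q H : ℕ) (hq : 0 < q) :
    ∑ i ∈ Finset.range H, ∑ j ∈ Finset.range H, (if i ≡ j [MOD q] then 1 else 0) =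
      q * (H / q) ^ 2 + 2 * (H % q) * (H / q) + H % q := by
  induction H with
  | zero => simp
  | succ H ih =>
    have hc : ∑ i ∈ Finset.range H, (if i ≡ H [MOD q] then 1 else 0) = H / q := by
      have := Nat.count_modEq_card H hq H
      rw [if_neg (lt_irrefl _), add_zero, Nat.count_eq_card_filter_range] at this
      rw [← this, Finset.card_filter]
    have hc' : ∑ i ∈ Finset.range H, (if H ≡ i [MOD q] then 1 else 0) = H / q := by
      rw [← hc]
      exact Finset.sum_congr rfl fun i _ => by simp only [Nat.ModEq.comm]
    simp only [Finset.sum_range_succ, Finset.sum_add_distrib, ih, hc, hc', Nat.ModEq.refl,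
      if_true]
    have hs := Nat.mod_lt H hq
    have hH := Nat.div_add_mod H q
    set N := H / q
    set s := H % q
    rcases (Nat.succ_le_of_lt hs).lt_or_eq with h | h
    · have hu := (Nat.div_mod_unique hq (a := H + 1) (c := s + 1) (d := N)).mpr ⟨by omega, h⟩
      rw [hu.1, hu.2]; ring
    · have hu := (Nat.div_mod_unique hq (a := H + 1) (c := 0) (d := N + 1)).mpr
        ⟨by rw [mul_add]; omega, hq⟩
      rw [hu.1, hu.2, ← h]; simp only [Nat.succ_eq_add_one]; ring

/-- The source of the fractional parts in `M`: the excess over `H ^ 2 / q` is `s - s ^ 2 / q` with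
`s = H % q`. -/
theorem sum_sum_modEq_eq (q H : ℕ) (hq : 0 < q) :
    ∑ i ∈ Finset.range H, ∑ j ∈ Finset.range H, (if i ≡ j [MOD q] then (1 : ℝ) else 0) =
      (H : ℝ) ^ 2 / q + q * (Int.fract (H / q : ℝ) * (1 - Int.fract (H / q : ℝ))) := by
  have h := congrArg (fun n : ℕ => (n : ℝ)) (sum_sum_modEq q H hq)
  push_cast at h
  rw [h, Int.fract_div_natCast_eq_div_natCast_mod]
  have hH : (q : ℝ) * (H / q : ℕ) + (H % q : ℕ) = H := by exact_mod_cast Nat.div_add_mod H q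
  have hq' : (q : ℝ) ≠ 0 := by exact_mod_cast hq.ne'
  generalize (H / q : ℕ) = N at *
  generalize (H % q : ℕ) = s at *
  rw [← hH]
  field_simp
  ring

theorem modEq_two_mul_prod_iff {y : ℕ} {S : Finset ℕ} (hS : S ⊆ oddPrimesUpTo y) (i j : ℕ) :
    i ≡ j [MOD 2 * ∏ p ∈ S, p] ↔ i ≡ j [MOD 2] ∧ ∀ p ∈ S, i ≡ j [MOD p] := by
  have hprod : ∀ S : Finset ℕ, S ⊆ oddPrimesUpTo y →
      (i ≡ j [MOD ∏ p ∈ S, p] ↔ ∀ p ∈ S, i ≡ j [MOD p]) := by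
    intro S
    induction S using Finset.induction_on with
    | empty => simp [Nat.modEq_one]
    | insert q S hq ih =>
      intro hS
      have hqp := (mem_oddPrimesUpTo.mp (hS (Finset.mem_insert_self q S))).1
      have hc : q.Coprime (∏ p ∈ S, p) := Nat.coprime_prod_right_iff.mpr fun p hp =>
        (Nat.coprime_primes hqp
          (mem_oddPrimesUpTo.mp (hS (Finset.mem_insert_of_mem hp))).1).mpr
          (by rintro rfl; exact hq hp)
      rw [Finset.prod_insert hq, ← Nat.modEq_and_modEq_iff_modEq_mul hc,
        ih ((Finset.subset_insert q S).trans hS)]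
      simp
  have hc : Nat.Coprime 2 (∏ p ∈ S, p) := Nat.coprime_prod_right_iff.mpr fun p hp =>
    (Nat.coprime_primes Nat.prime_two (mem_oddPrimesUpTo.mp (hS hp)).1).mpr (by
      rintro rfl; exact two_notMem_oddPrimesUpTo y (hS hp))
  rw [← Nat.modEq_and_modEq_iff_modEq_mul hc, hprod S hS]

/-- The product of `1 - 2 / p` over the odd primes `p ≤ y`. -/
def twinDensity (y : ℕ) : ℝ := ∏ p ∈ oddPrimesUpTo y, (1 - 2 / (p : ℝ))

/-- At an odd prime the local factor is `1 - 2 / p`, times `1 + 1 / (p - 2)` when `i ≡ j`; multiply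
out. The prime 2 contributes `1 / 2` or 0, whence the 2 in the modulus. -/
theorem pairDensity_eq_sum {y : ℕ} (hy : 2 ≤ y) (i j : ℕ) : pairDensity i j y =
    1 / 2 * twinDensity y * ∑ S ∈ (oddPrimesUpTo y).powerset,
      (∏ p ∈ S, (1 / ((p : ℝ) - 2))) * (if i ≡ j [MOD 2 * ∏ p ∈ S, p] then 1 else 0) := by
  rw [pairDensity, primesUpTo_eq_insert hy, Finset.prod_insert (two_notMem_oddPrimesUpTo y)]
  have e1 : ∀ p ∈ oddPrimesUpTo y, (1 - nu i j p / p : ℝ) =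
      (1 - 2 / p) * (1 + 1 / ((p : ℝ) - 2) * (if i ≡ j [MOD p] then 1 else 0)) := by
    intro p hp
    have h3 : (3 : ℝ) ≤ p := by exact_mod_cast (mem_oddPrimesUpTo.mp hp).2.1
    have h1 : (p : ℝ) ≠ 0 := by linarith
    have h2 : (p : ℝ) - 2 ≠ 0 := by linarith
    unfold nu
    split_ifs <;> push_cast
    · field_simp; ring
    · ring
  have e2 : ∀ S ∈ (oddPrimesUpTo y).powerset,
      ∏ p ∈ S, (1 / ((p : ℝ) - 2) * (if i ≡ j [MOD p] then 1 else 0)) =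
      (∏ p ∈ S, (1 / ((p : ℝ) - 2))) * (if ∀ p ∈ S, i ≡ j [MOD p] then 1 else 0) := by
    intro S _
    rw [Finset.prod_mul_distrib, Finset.prod_ite_zero, Finset.prod_const_one]
  rw [Finset.prod_congr rfl e1, Finset.prod_mul_distrib, Finset.prod_one_add,
    Finset.sum_congr rfl e2, ← mul_assoc]
  by_cases h2 : i ≡ j [MOD 2]
  · have : (1 : ℝ) - (nu i j 2 : ℕ) / (2 : ℕ) = 1 / 2 := by
      simp only [nu, h2, if_true]; norm_num
    rw [this]
    refine congrArg₂ _ rfl (Finset.sum_congr rfl fun S hS => ?_)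
    simp only [modEq_two_mul_prod_iff (Finset.mem_powerset.mp hS), h2, true_and]
  · have : (1 : ℝ) - (nu i j 2 : ℕ) / (2 : ℕ) = 0 := by
      simp only [nu, h2, if_false]; norm_num
    rw [this, zero_mul, zero_mul]
    refine (mul_eq_zero_of_right _ (Finset.sum_eq_zero fun S hS => ?_)).symm
    simp only [modEq_two_mul_prod_iff (Finset.mem_powerset.mp hS), h2, false_and, if_false,
      mul_zero]

theorem squarefree_prod_primes {S : Finset ℕ} (hS : ∀ p ∈ S, p.Prime) :
    Squarefree (∏ p ∈ S, p) := by
  refine Finset.squarefree_prod_of_pairwise_isCoprime (fun p hp q hq hpq => ?_)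
    fun p hp => (hS p hp).squarefree
  exact Nat.coprime_iff_isRelPrime.mp ((Nat.coprime_primes (hS p hp) (hS q hq)).mpr hpq)

theorem tsum_g_mul (y : ℕ) (F : ℕ → ℝ) : ∑' n : ℕ, g y n * F n =
    ∑ S ∈ (oddPrimesUpTo y).powerset, (∏ p ∈ S, ((p : ℝ) / (p - 2))) * F (∏ p ∈ S, p) := by
  have hprime : ∀ S ∈ (oddPrimesUpTo y).powerset, ∀ p ∈ S, p.Prime := fun S hS p hp =>
    (mem_oddPrimesUpTo.mp (Finset.mem_powerset.mp hS hp)).1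
  rw [tsum_eq_sum (s := (oddPrimesUpTo y).powerset.image fun S => ∏ p ∈ S, p),
    Finset.sum_image]
  · refine Finset.sum_congr rfl fun S hS => ?_
    rw [g, if_pos (squarefree_prod_primes (hprime S hS)), Nat.primeFactors_prod (hprime S hS)]
    congr 1
    refine Finset.prod_congr rfl fun p hp => ?_
    obtain ⟨-, h3, hpy⟩ := mem_oddPrimesUpTo.mp (Finset.mem_powerset.mp hS hp)
    rw [gPrime, if_pos ⟨h3, hpy⟩]
  · intro S hS S' hS' h
    have := congrArg Nat.primeFactors h
    dsimp only at this
    rwa [Nat.primeFactors_prod (hprime S hS), Nat.primeFactors_prod (hprime S' hS')] at this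
  · intro n hn
    by_contra h
    have hg : g y n ≠ 0 := fun h0 => h (by rw [h0, zero_mul])
    have hsq : Squarefree n := by
      by_contra hs; exact hg (by simp [g, hs])
    rw [g, if_pos hsq, Finset.prod_ne_zero_iff] at hg
    refine hn (Finset.mem_image.mpr ⟨n.primeFactors, Finset.mem_powerset.mpr fun p hp => ?_,
      Nat.prod_primeFactors_of_squarefree hsq⟩)
    have := hg p hp
    rw [gPrime] at this
    split_ifs at this with hp2
    · exact mem_oddPrimesUpTo.mpr ⟨Nat.prime_of_mem_primeFactors hp, hp2.1, hp2.2⟩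
    · exact absurd rfl this

theorem M_eq_sum (H y : ℕ) : M H y = twinDensity y * ∑ S ∈ (oddPrimesUpTo y).powerset,
    (∏ p ∈ S, ((p : ℝ) / (p - 2))) * (Int.fract ((H : ℝ) / (2 * (∏ p ∈ S, p : ℕ))) *
      (1 - Int.fract ((H : ℝ) / (2 * (∏ p ∈ S, p : ℕ))))) := by
  rw [← tsum_g_mul y fun n : ℕ => Int.fract ((H : ℝ) / (2 * (n : ℝ))) *
      (1 - Int.fract ((H : ℝ) / (2 * (n : ℝ)))), M]
  simp only [mul_assoc]
  rfl

theorem roughDensity_eq {y : ℕ} (hy : 2 ≤ y) :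
    roughDensity y = 1 / 2 * ∏ p ∈ oddPrimesUpTo y, (1 - 1 / (p : ℝ)) := by
  have : roughDensity y = ∏ p ∈ primesUpTo y, (1 - 1 / (p : ℝ)) := rfl
  rw [this, primesUpTo_eq_insert hy, Finset.prod_insert (two_notMem_oddPrimesUpTo y)]
  norm_num

/-- Counting congruent pairs for each modulus leaves two parts. The fractional parts form `M`; the
terms `H ^ 2 / q` recombine through `(1 - 2 / p) * (1 + 1 / (p * (p - 2))) = (1 - 1 / p) ^ 2`. -/
theorem sum_sum_pairDensity {y : ℕ} (hy : 2 ≤ y) (H : ℕ) :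
    ∑ i ∈ Finset.range H, ∑ j ∈ Finset.range H, pairDensity (i + 1) (j + 1) y =
      M H y + (H * roughDensity y) ^ 2 := by
  have hmod : ∀ q i j : ℕ, i + 1 ≡ j + 1 [MOD q] ↔ i ≡ j [MOD q] := fun q i j =>
    ⟨Nat.ModEq.add_right_cancel' 1, Nat.ModEq.add_right 1⟩
  have hpos : ∀ S ∈ (oddPrimesUpTo y).powerset, 0 < ∏ p ∈ S, p := fun S hS =>
    Finset.prod_pos fun p hp => (mem_oddPrimesUpTo.mp (Finset.mem_powerset.mp hS hp)).1.pos
  simp only [pairDensity_eq_sum hy, hmod, ← Finset.mul_sum]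
  have e1 : ∑ i ∈ Finset.range H, ∑ j ∈ Finset.range H, ∑ S ∈ (oddPrimesUpTo y).powerset,
      (∏ p ∈ S, (1 / ((p : ℝ) - 2))) * (if i ≡ j [MOD 2 * ∏ p ∈ S, p] then (1 : ℝ) else 0) =
      ∑ S ∈ (oddPrimesUpTo y).powerset, (∏ p ∈ S, (1 / ((p : ℝ) - 2))) *
      ((H : ℝ) ^ 2 / (2 * ∏ p ∈ S, p : ℕ) + (2 * ∏ p ∈ S, p : ℕ) *
        (Int.fract (H / (2 * ∏ p ∈ S, p : ℕ) : ℝ) *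
          (1 - Int.fract (H / (2 * ∏ p ∈ S, p : ℕ) : ℝ)))) := by
    rw [Finset.sum_congr rfl fun i _ => Finset.sum_comm, Finset.sum_comm]
    refine Finset.sum_congr rfl fun S hS => ?_
    rw [← sum_sum_modEq_eq _ _ (Nat.mul_pos two_pos (hpos S hS))]
    simp only [Finset.mul_sum]
  rw [e1, M_eq_sum]
  simp only [mul_add, Finset.sum_add_distrib]
  rw [add_comm]
  congr 1
  · rw [mul_comm (1 / 2 : ℝ), mul_assoc, Finset.mul_sum]
    refine congrArg _ (Finset.sum_congr rfl fun S hS => ?_)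
    have e : ∏ p ∈ S, ((p : ℝ) / (p - 2)) =
        (∏ p ∈ S, (1 / ((p : ℝ) - 2))) * ((∏ p ∈ S, p : ℕ) : ℝ) := by
      push_cast
      rw [← Finset.prod_mul_distrib]
      exact Finset.prod_congr rfl fun p _ => by ring
    rw [e]
    push_cast
    ring
  · have e : ∀ S ∈ (oddPrimesUpTo y).powerset, (∏ p ∈ S, (1 / ((p : ℝ) - 2))) *
        ((H : ℝ) ^ 2 / (2 * ∏ p ∈ S, p : ℕ)) =
        H ^ 2 / 2 * ∏ p ∈ S, (1 / ((p : ℝ) * (p - 2))) := by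
      intro S hS
      have : ∏ p ∈ S, (1 / ((p : ℝ) * (p - 2))) =
          (∏ p ∈ S, (1 / ((p : ℝ) - 2))) * (1 / ((∏ p ∈ S, p : ℕ) : ℝ)) := by
        push_cast
        rw [one_div (∏ p ∈ S, (p : ℝ)), ← Finset.prod_inv_distrib, ← Finset.prod_mul_distrib]
        exact Finset.prod_congr rfl fun p _ => by rw [one_div_mul_eq_div, one_div, mul_inv]; ring
      rw [this]
      push_cast
      ring
    rw [Finset.sum_congr rfl e, ← Finset.mul_sum, ← Finset.prod_one_add, roughDensity_eq hy,
      twinDensity]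
    have e3 : (∏ p ∈ oddPrimesUpTo y, (1 - 2 / (p : ℝ))) *
        ∏ p ∈ oddPrimesUpTo y, (1 + 1 / ((p : ℝ) * (p - 2))) =
        (∏ p ∈ oddPrimesUpTo y, (1 - 1 / (p : ℝ))) ^ 2 := by
      rw [← Finset.prod_mul_distrib, ← Finset.prod_pow]
      refine Finset.prod_congr rfl fun p hp => ?_
      have h3 : (3 : ℝ) ≤ p := by exact_mod_cast (mem_oddPrimesUpTo.mp hp).2.1
      have h1 : (p : ℝ) ≠ 0 := by linarith
      have h2 : (p : ℝ) - 2 ≠ 0 := by linarith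
      field_simp
      ring
    linear_combination (H ^ 2 / 4 : ℝ) * e3

/-- A uniform bound for the counting error on pairs bounds the error for the variance. -/
theorem abs_V_sub_M_le {X H y : ℕ} (hX : 0 < X) (hy : 2 ≤ y) {E : ℝ}
    (hE : ∀ i j, |pairCount X i j y / X - pairDensity i j y| ≤ E) :
    |V X H y - M H y| ≤ 3 * H ^ 2 * E := by
  have hM := sum_sum_pairDensity hy H
  set P := roughDensity y
  have hP0 : 0 ≤ P := roughDensity_nonneg y
  have hP1 : P ≤ 1 := roughDensity_le_one y
  have e : V X H y - M H y = (∑ i ∈ Finset.range H, ∑ j ∈ Finset.range H,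
      (pairCount X (i + 1) (j + 1) y / X - pairDensity (i + 1) (j + 1) y)) -
      2 * (H * P) * ∑ i ∈ Finset.range H,
        (pairCount X (i + 1) (i + 1) y / X - pairDensity (i + 1) (i + 1) y) := by
    rw [V_eq_pairCount hX]
    simp only [Finset.sum_sub_distrib, hM, pairDensity_self, Finset.sum_const,
      Finset.card_range, nsmul_eq_mul]
    ring
  have hE0 : 0 ≤ E := (abs_nonneg _).trans (hE 0 0)
  have b1 : |∑ i ∈ Finset.range H, ∑ j ∈ Finset.range H,
      (pairCount X (i + 1) (j + 1) y / X - pairDensity (i + 1) (j + 1) y)| ≤ H ^ 2 * E := by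
    refine (Finset.abs_sum_le_sum_abs _ _).trans ((Finset.sum_le_card_nsmul _ _ (H * E)
      fun i _ => ?_).trans (le_of_eq ?_))
    · refine (Finset.abs_sum_le_sum_abs _ _).trans ((Finset.sum_le_card_nsmul _ _ E
        fun j _ => hE _ _).trans (le_of_eq ?_))
      simp
    · simp only [Finset.card_range, nsmul_eq_mul]; ring
  have b2 : |∑ i ∈ Finset.range H,
      (pairCount X (i + 1) (i + 1) y / X - pairDensity (i + 1) (i + 1) y)| ≤ H * E := by
    refine (Finset.abs_sum_le_sum_abs _ _).trans ((Finset.sum_le_card_nsmul _ _ E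
      fun i _ => hE _ _).trans (le_of_eq ?_))
    simp
  have hH : (0 : ℝ) ≤ H := Nat.cast_nonneg H
  rw [e]
  refine (abs_sub _ _).trans ?_
  rw [abs_mul, abs_of_nonneg (by positivity : 0 ≤ 2 * (H * P))]
  have b3 : 2 * (H * P) * |∑ i ∈ Finset.range H,
      (pairCount X (i + 1) (i + 1) y / X - pairDensity (i + 1) (i + 1) y)| ≤
      2 * (H * 1) * (H * E) := by gcongr
  nlinarith

/-! ### The counting error on pairs -/

/-- The product of `1 - 1 / n` over all `2 ≤ n ≤ y` telescopes to `1 / y`. -/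
theorem one_div_le_roughDensity {y : ℕ} (hy : 1 ≤ y) : 1 / (y : ℝ) ≤ roughDensity y := by
  induction y, hy using Nat.le_induction with
  | base =>
    have : (Finset.Icc 1 1).filter Nat.Prime = ∅ := by decide
    rw [roughDensity, this]; simp
  | succ y hy ih =>
    have hy' : (0 : ℝ) < y := by exact_mod_cast hy
    have h1 : (1 : ℝ) / (y + 1 : ℕ) = 1 / y * (1 - 1 / (y + 1 : ℕ)) := by
      push_cast; field_simp; ring
    have hd0 : (0 : ℝ) ≤ 1 / (y + 1 : ℕ) := by positivity
    have hd1 : (1 : ℝ) / (y + 1 : ℕ) ≤ 1 := by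
      rw [div_le_one (by positivity)]; push_cast; linarith
    have h2 : roughDensity y * (1 - 1 / (y + 1 : ℕ)) ≤ roughDensity (y + 1) := by
      have hI : Finset.Icc 1 (y + 1) = insert (y + 1) (Finset.Icc 1 y) := by
        ext n; simp only [Finset.mem_Icc, Finset.mem_insert]; omega
      unfold roughDensity
      rw [hI, Finset.filter_insert]
      split_ifs
      · rw [Finset.prod_insert (by simp), mul_comm]
      · exact mul_le_of_le_one_right (roughDensity_nonneg y) (by linarith)
    rw [h1]
    exact (mul_le_mul_of_nonneg_right ih (by linarith)).trans h2

theorem pairCount_eq_zero {y i j : ℕ} (hy : 2 ≤ y) (hij : ¬ i ≡ j [MOD 2]) (X : ℕ) :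
    pairCount X i j y = 0 := by
  refine Finset.sum_eq_zero fun m _ => Finset.prod_eq_zero
    (mem_primesUpTo.mpr ⟨Nat.prime_two, hy⟩) ?_
  have : 2 ∣ m + i ∨ 2 ∣ m + j := by
    unfold Nat.ModEq at hij; omega
  rw [hit, if_pos this, sub_self]

theorem pairDensity_eq_zero {y i j : ℕ} (hy : 2 ≤ y) (hij : ¬ i ≡ j [MOD 2]) :
    pairDensity i j y = 0 := by
  refine Finset.prod_eq_zero (mem_primesUpTo.mpr ⟨Nat.prime_two, hy⟩) ?_
  simp only [nu, hij, if_false]; norm_num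

/-- The 7 is 1 for the remainder plus `2 * 3` for the relative error, as `exp (sieveSaving k) ≤ 3`.
The exponent is `k + 25` from the remainder, 2 from `y + 1 ≤ y ^ 2` and 1 from `P ≥ 1 / y`. -/
theorem abs_pairCount_div_sub_le {k y X : ℕ} (hk0 : 0 < k) (hk : Even k) (hy : 2 ≤ y)
    (hky : k + 1 ≤ 2 * y) (hX : y ^ (k + 28) ≤ X) (hs : sieveSaving k ≤ 1) (i j : ℕ) :
    |pairCount X i j y / X - pairDensity i j y| ≤ 7 * (roughDensity y * sieveSaving k) := by
  have hs0 := sieveSaving_nonneg k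
  have hP0 := roughDensity_nonneg y
  by_cases hij : i ≡ j [MOD 2]
  swap
  · rw [pairCount_eq_zero hy hij, pairDensity_eq_zero hy hij]
    simp only [zero_div, sub_zero, abs_zero]; positivity
  have hy2 : (2 : ℝ) ≤ y := by exact_mod_cast hy
  have hX' : (y : ℝ) ^ (k + 28) ≤ X := by exact_mod_cast hX
  have hX0 : (0 : ℝ) < X := lt_of_lt_of_le (by positivity) hX'
  have h := abs_sum_prod_one_sub_hit_sub_le hk0 hk hy hky X i j hij
  have e : pairCount X i j y / X - pairDensity i j y =
      (pairCount X i j y - X * pairDensity i j y) / X := by field_simp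
  rw [e, abs_div, abs_of_pos hX0, div_le_iff₀ hX0]
  refine h.trans ?_
  change _ + 2 * X * pairDensity i j y * (sieveSaving k * Real.exp (sieveSaving k)) ≤ _
  have hexp : Real.exp (sieveSaving k) ≤ 3 :=
    (Real.exp_le_exp.mpr hs).trans (by linarith [Real.exp_one_lt_d9])
  have h2 : 2 * X * pairDensity i j y * (sieveSaving k * Real.exp (sieveSaving k)) ≤
      2 * X * roughDensity y * (sieveSaving k * 3) := by
    have := pairDensity_le i j y
    gcongr
  have h1 : ((y : ℝ) + 1) * ((k + 2) * ((2 * y : ℝ) ^ (k + 1) / (k + 1).factorial) * y ^ 24) ≤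
      X * roughDensity y * sieveSaving k := by
    have hΛ := sixteen_le_blockBound k
    have hk' : (0 : ℝ) ≤ k := Nat.cast_nonneg k
    have hlog : Real.log (k + 4) ≤ 4 * blockBound k := by
      have : 0 ≤ Real.log (k + 4) := Real.log_nonneg (by linarith)
      unfold blockBound; linarith
    have ha : (k : ℝ) + 2 ≤ Real.exp (4 * blockBound k) := by
      have := (Real.log_le_iff_le_exp (by linarith)).mp hlog
      linarith
    have hb : ((k : ℝ) + 2) * (2 ^ (k + 1) / (k + 1).factorial) ≤ sieveSaving k := by
      unfold sieveSaving
      have : (2 : ℝ) ^ (k + 1) ≤ blockBound k ^ (k + 1) := by gcongr; linarith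
      gcongr
    have hc : ((y : ℝ) + 1) * y ^ (k + 25) ≤ X * roughDensity y := by
      have hP := one_div_le_roughDensity (y := y) (by omega)
      have h3 : (y : ℝ) + 1 ≤ y ^ 2 := by nlinarith
      calc ((y : ℝ) + 1) * y ^ (k + 25) ≤ y ^ 2 * y ^ (k + 25) := by gcongr
        _ = y ^ (k + 28) * (1 / y) := by field_simp; ring
        _ ≤ X * roughDensity y := by gcongr
    calc ((y : ℝ) + 1) * ((k + 2) * ((2 * y : ℝ) ^ (k + 1) / (k + 1).factorial) * y ^ 24) =
          (((y : ℝ) + 1) * y ^ (k + 25)) * ((k + 2) * (2 ^ (k + 1) / (k + 1).factorial)) := by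
            rw [mul_pow]; ring
      _ ≤ X * roughDensity y * sieveSaving k := by gcongr
  linarith

/-- The sieve saves a factor `k ^ k`, up to lower order terms in the exponent. -/
theorem eventually_sieveSaving_le {η : ℝ} (hη : 0 < η) :
    ∀ᶠ k : ℕ in atTop, sieveSaving k ≤ Real.exp (-((1 - η) * (k * Real.log k))) := by
  -- The cap at 1 keeps `log Λ + 1 - log k` nonpositive even for large `η`.
  have hη2 : 0 < min (η / 2) 1 := by positivity
  have hlo : ∀ r : ℝ, 0 < r → ∀ᶠ x : ℝ in atTop, 256 * Real.log x ≤ x ^ r := by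
    intro r hr
    filter_upwards [(isLittleO_log_rpow_atTop hr).bound (by norm_num : (0 : ℝ) < 1 / 256),
      eventually_ge_atTop 1] with x hx h1
    rw [Real.norm_of_nonneg (Real.log_nonneg h1), Real.norm_of_nonneg (by positivity)] at hx
    linarith
  have hcast := tendsto_natCast_atTop_atTop (R := ℝ)
  filter_upwards [hcast.eventually (hlo _ hη2), hcast.eventually (hlo 1 one_pos),
    hcast.eventually ((Real.tendsto_log_atTop).eventually_ge_atTop (2 / η)),
    hcast.eventually ((Real.tendsto_log_atTop).eventually_ge_atTop 2),
    eventually_ge_atTop 4] with k h1 h2 h3 h3' h4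
  rw [Real.rpow_one] at h2
  have hk4 : (4 : ℝ) ≤ k := by exact_mod_cast h4
  have hk0 : (0 : ℝ) < k := by linarith
  set Λ := blockBound k with hΛ
  have hΛ16 : 16 ≤ Λ := sixteen_le_blockBound k
  have hlog : Λ ≤ 32 * Real.log k := by
    have : Real.log (k + 4) ≤ Real.log 2 + Real.log k := by
      rw [← Real.log_mul (by norm_num) hk0.ne']
      exact Real.log_le_log (by linarith) (by linarith)
    have := Real.log_two_lt_d9
    rw [hΛ]; unfold blockBound; linarith
  have hA : 4 * Λ ≤ k := by linarith
  have hB : Real.log Λ + 1 ≤ min (η / 2) 1 * Real.log k := by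
    have h5 : Λ * Real.exp 1 ≤ (k : ℝ) ^ (min (η / 2) 1) := by
      have he : Real.exp 1 ≤ 3 := by linarith [Real.exp_one_lt_d9]
      calc Λ * Real.exp 1 ≤ (32 * Real.log k) * 3 := by gcongr
        _ ≤ 256 * Real.log k := by linarith
        _ ≤ _ := h1
    have h6 := Real.log_le_log (by positivity) h5
    rwa [Real.log_mul (by positivity) (Real.exp_pos 1).ne', Real.log_exp,
      Real.log_rpow hk0] at h6
  have hfac : (1 : ℝ) / (k + 1).factorial ≤ Real.exp (k + 1) / (k : ℝ) ^ (k + 1) := by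
    have h7 := Real.pow_div_factorial_le_exp (k + 1 : ℝ) (by positivity) (k + 1)
    rw [div_le_div_iff₀ (by positivity) (by positivity)]
    rw [div_le_iff₀ (by positivity)] at h7
    have : (k : ℝ) ^ (k + 1) ≤ (k + 1 : ℝ) ^ (k + 1) := by gcongr; linarith
    linarith
  have hmain : sieveSaving k ≤ Real.exp (4 * Λ + (k + 1) * (Real.log Λ + 1 - Real.log k)) := by
    have e1 : Real.exp (4 * Λ + (k + 1) * (Real.log Λ + 1 - Real.log k)) =
        Real.exp (4 * Λ) * (Λ ^ (k + 1) * (Real.exp (k + 1) / (k : ℝ) ^ (k + 1))) := by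
      have e2 : Λ ^ (k + 1) = Real.exp ((k + 1) * Real.log Λ) := by
        rw [← Real.exp_log (pow_pos (by linarith : 0 < Λ) (k + 1)), Real.log_pow]; push_cast; rfl
      have e3 : (k : ℝ) ^ (k + 1) = Real.exp ((k + 1) * Real.log k) := by
        rw [← Real.exp_log (pow_pos hk0 (k + 1)), Real.log_pow]; push_cast; rfl
      rw [e2, e3, ← Real.exp_sub, ← Real.exp_add, ← Real.exp_add]
      congr 1; ring
    rw [e1, sieveSaving, ← hΛ, div_eq_mul_one_div]
    gcongr
  refine hmain.trans (Real.exp_le_exp.mpr ?_)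
  have hC : (k : ℝ) ≤ η / 2 * (k * Real.log k) := by
    rw [div_le_iff₀ hη] at h3
    nlinarith
  have hm1 : min (η / 2) 1 ≤ 1 := min_le_right _ _
  have hm2 : min (η / 2) 1 ≤ η / 2 := min_le_left _ _
  have hL : 0 ≤ Real.log k := by linarith
  have hD : (k + 1 : ℝ) * (Real.log Λ + 1 - Real.log k) ≤
      k * ((η / 2 - 1) * Real.log k) := by
    have h8 : Real.log Λ + 1 - Real.log k ≤ 0 := by nlinarith
    have h9 : Real.log Λ + 1 - Real.log k ≤ (η / 2 - 1) * Real.log k := by nlinarith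
    nlinarith
  linarith

/-! ### A lower bound for the main term -/

theorem twinDensity_nonneg (y : ℕ) : 0 ≤ twinDensity y :=
  Finset.prod_nonneg fun p hp => by
    have h3 : (3 : ℝ) ≤ p := by exact_mod_cast (mem_oddPrimesUpTo.mp hp).2.1
    rw [sub_nonneg, div_le_one (by linarith)]
    linarith

/-- The sum of `∏ p ∈ S, 1 / (p - 2)` over the sets `S` of odd primes with product at least `H`. -/
def tailSum (H y : ℕ) : ℝ :=
  ∑ S ∈ (oddPrimesUpTo y).powerset with H ≤ ∏ p ∈ S, p, ∏ p ∈ S, (1 / ((p : ℝ) - 2))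

/-- If `n ≥ H`, then `H / (2 * n) ≤ 1 / 2` is its own fractional part and `n * {·} * (1 - {·}) ≥ H /
4`. The other terms are nonnegative. -/
theorem le_M (H y : ℕ) : H / 4 * (twinDensity y * tailSum H y) ≤ M H y := by
  rw [M_eq_sum, mul_left_comm]
  refine mul_le_mul_of_nonneg_left ?_ (twinDensity_nonneg y)
  have h3 : ∀ S ∈ (oddPrimesUpTo y).powerset, ∀ p ∈ S, (3 : ℝ) ≤ p := fun S hS p hp => by
    exact_mod_cast (mem_oddPrimesUpTo.mp (Finset.mem_powerset.mp hS hp)).2.1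
  rw [tailSum, Finset.mul_sum]
  refine (Finset.sum_le_sum fun S hS => ?_).trans
    (Finset.sum_le_sum_of_subset_of_nonneg (Finset.filter_subset _ _) fun S hS _ => ?_)
  · obtain ⟨hS, hH⟩ := Finset.mem_filter.mp hS
    have hn : 0 < ∏ p ∈ S, p := Finset.prod_pos fun p hp =>
      (mem_oddPrimesUpTo.mp (Finset.mem_powerset.mp hS hp)).1.pos
    have e : ∏ p ∈ S, ((p : ℝ) / (p - 2)) =
        (∏ p ∈ S, (1 / ((p : ℝ) - 2))) * ((∏ p ∈ S, p : ℕ) : ℝ) := by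
      push_cast
      rw [← Finset.prod_mul_distrib]
      exact Finset.prod_congr rfl fun p _ => by ring
    have hw : 0 ≤ ∏ p ∈ S, (1 / ((p : ℝ) - 2)) := Finset.prod_nonneg fun p hp => by
      have := h3 S hS p hp
      exact div_nonneg zero_le_one (by linarith)
    rw [e, mul_assoc, mul_comm]
    refine mul_le_mul_of_nonneg_left ?_ hw
    set n := ∏ p ∈ S, p
    have hn' : (0 : ℝ) < n := by exact_mod_cast hn
    have hH' : (H : ℝ) ≤ n := by exact_mod_cast hH
    have hH0 : (0 : ℝ) ≤ H := Nat.cast_nonneg H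
    have hle : (H : ℝ) / (2 * n) ≤ 1 / 2 := by
      rw [div_le_div_iff₀ (by positivity) (by norm_num)]; linarith
    have hfr : Int.fract ((H : ℝ) / (2 * n)) = H / (2 * n) :=
      Int.fract_eq_self.mpr ⟨by positivity, by linarith⟩
    rw [hfr]
    have e2 : (n : ℝ) * ((H : ℝ) / (2 * n) * (1 - H / (2 * n))) =
        H / 2 * (1 - H / (2 * n)) := by field_simp
    rw [e2]
    nlinarith
  · refine mul_nonneg (Finset.prod_nonneg fun p hp => ?_) (mul_nonneg (Int.fract_nonneg _) ?_)
    · have := h3 S hS p hp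
      exact div_nonneg (by linarith) (by linarith)
    · linarith [Int.fract_lt_one ((H : ℝ) / (2 * (∏ p ∈ S, p : ℕ)))]

/-- Sets of `K` primes exceeding `z`, where `H ≤ z ^ K`, contribute to the tail. -/
theorem le_tailSum {H y K : ℕ} {z : ℝ} (hz : 0 ≤ z) (hHz : (H : ℝ) ≤ z ^ K) (A : Finset ℕ)
    (hA : A ⊆ oddPrimesUpTo y) (hAz : ∀ p ∈ A, z ≤ p) :
    (A.card.choose K : ℝ) * (1 / (y : ℝ)) ^ K ≤ tailSum H y := by
  have hsub : A.powersetCard K ⊆ {S ∈ (oddPrimesUpTo y).powerset | H ≤ ∏ p ∈ S, p} := by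
    intro S hS
    obtain ⟨hSA, hK⟩ := Finset.mem_powersetCard.mp hS
    refine Finset.mem_filter.mpr ⟨Finset.mem_powerset.mpr (hSA.trans hA), ?_⟩
    have : (H : ℝ) ≤ (∏ p ∈ S, p : ℕ) := by
      refine hHz.trans ?_
      push_cast
      rw [← hK, ← Finset.prod_const]
      exact Finset.prod_le_prod (fun _ _ => hz) fun p hp => hAz p (hSA hp)
    exact_mod_cast this
  have h3 : ∀ p ∈ oddPrimesUpTo y, (3 : ℝ) ≤ p ∧ (p : ℝ) ≤ y := fun p hp =>
    ⟨by exact_mod_cast (mem_oddPrimesUpTo.mp hp).2.1,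
      by exact_mod_cast (mem_oddPrimesUpTo.mp hp).2.2⟩
  unfold tailSum
  refine le_trans ?_ (Finset.sum_le_sum_of_subset_of_nonneg hsub fun S hS _ => ?_)
  · rw [← Finset.card_powersetCard, ← nsmul_eq_mul]
    refine Finset.card_nsmul_le_sum _ _ _ fun S hS => ?_
    obtain ⟨hSA, hK⟩ := Finset.mem_powersetCard.mp hS
    rw [← hK, ← Finset.prod_const]
    refine Finset.prod_le_prod (fun _ _ => by positivity) fun p hp => ?_
    obtain ⟨h1, h2⟩ := h3 p (hA (hSA hp))
    exact one_div_le_one_div_of_le (by linarith) (by linarith)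
  · refine Finset.prod_nonneg fun p hp => ?_
    have := (h3 p (Finset.mem_powerset.mp (Finset.mem_filter.mp hS).1 hp)).1
    exact div_nonneg zero_le_one (by linarith)

/-- The tail is large if there are enough primes between `H` and `y`. -/
theorem le_twinDensity_mul_tailSum {H y : ℕ} (hy : 2 ≤ y) (B : Finset ℕ)
    (hB : B ⊆ oddPrimesUpTo y) (hBH : ∀ p ∈ B, H < p) {t : ℝ} (ht0 : 0 ≤ t) (ht1 : t ≤ 1)
    (ht : t ≤ ∑ p ∈ B, (1 / p : ℝ)) :
    roughDensity y * t ≤ twinDensity y * tailSum H y := by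
  have h3 : ∀ p ∈ oddPrimesUpTo y, (3 : ℝ) ≤ p := fun p hp => by
    exact_mod_cast (mem_oddPrimesUpTo.mp hp).2.1
  have hw : ∀ S ∈ (oddPrimesUpTo y).powerset, 0 ≤ ∏ p ∈ S, (1 / ((p : ℝ) - 2)) := fun S hS =>
    Finset.prod_nonneg fun p hp => by
      have := h3 p (Finset.mem_powerset.mp hS hp)
      exact div_nonneg zero_le_one (by linarith)
  have hsplit : tailSum H y + ∑ S ∈ (oddPrimesUpTo y).powerset with ¬ H ≤ ∏ p ∈ S, p,
      ∏ p ∈ S, (1 / ((p : ℝ) - 2)) = ∏ p ∈ oddPrimesUpTo y, (1 + 1 / ((p : ℝ) - 2)) := by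
    rw [Finset.prod_one_add, tailSum]
    exact Finset.sum_filter_add_sum_filter_not _ _ _
  -- A set with product below `H` contains no prime of `B`, so the complement of the tail loses the
  -- factors at `B`.
  have hsmall : ∑ S ∈ (oddPrimesUpTo y).powerset with ¬ H ≤ ∏ p ∈ S, p,
      ∏ p ∈ S, (1 / ((p : ℝ) - 2)) ≤
      ∏ p ∈ oddPrimesUpTo y \ B, (1 + 1 / ((p : ℝ) - 2)) := by
    rw [Finset.prod_one_add]
    refine Finset.sum_le_sum_of_subset_of_nonneg (fun S hS => ?_) fun S hS _ =>
      hw S (Finset.mem_powerset.mpr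
        ((Finset.mem_powerset.mp hS).trans Finset.sdiff_subset))
    obtain ⟨hS, hlt⟩ := Finset.mem_filter.mp hS
    rw [Finset.mem_powerset] at hS ⊢
    intro p hp
    refine Finset.mem_sdiff.mpr ⟨hS hp, fun hpB => hlt ?_⟩
    have hle : p ≤ ∏ q ∈ S, q := Nat.le_of_dvd
      (Finset.prod_pos fun q hq => (mem_oddPrimesUpTo.mp (hS hq)).1.pos)
      (Finset.dvd_prod_of_mem _ hp)
    exact (hBH p hpB).le.trans hle
  have hall : twinDensity y * ∏ p ∈ oddPrimesUpTo y, (1 + 1 / ((p : ℝ) - 2)) =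
      2 * roughDensity y := by
    rw [roughDensity_eq hy, twinDensity, ← Finset.prod_mul_distrib, ← mul_assoc,
      mul_one_div_cancel two_ne_zero, one_mul]
    refine Finset.prod_congr rfl fun p hp => ?_
    have := h3 p hp
    have h1 : (p : ℝ) ≠ 0 := by linarith
    have h2 : (p : ℝ) - 2 ≠ 0 := by linarith
    field_simp; ring
  have hBprod : ∏ p ∈ oddPrimesUpTo y \ B, (1 + 1 / ((p : ℝ) - 2)) ≤
      Real.exp (-t) * ∏ p ∈ oddPrimesUpTo y, (1 + 1 / ((p : ℝ) - 2)) := by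
    rw [← Finset.prod_sdiff hB]
    have h4 : Real.exp t ≤ ∏ p ∈ B, (1 + 1 / ((p : ℝ) - 2)) := by
      refine (Real.exp_le_exp.mpr ht).trans ?_
      rw [Real.exp_sum]
      refine Finset.prod_le_prod (fun _ _ => (Real.exp_pos _).le) fun p hp => ?_
      have h3p := h3 p (hB hp)
      have hpos : (0 : ℝ) < 1 + 1 / ((p : ℝ) - 2) := by
        have : 0 < 1 / ((p : ℝ) - 2) := one_div_pos.mpr (by linarith)
        linarith
      rw [← Real.le_log_iff_exp_le hpos]
      refine le_trans ?_ (Real.one_sub_inv_le_log_of_pos hpos)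
      have h1 : (p : ℝ) - 1 ≠ 0 := by linarith
      have h2 : (p : ℝ) - 2 ≠ 0 := by linarith
      have e : 1 - (1 + 1 / ((p : ℝ) - 2))⁻¹ = 1 / (p - 1) := by
        have e' : 1 + 1 / ((p : ℝ) - 2) = (p - 1) / (p - 2) := by field_simp; ring
        rw [e', inv_div]; field_simp; ring
      rw [e]
      exact one_div_le_one_div_of_le (by linarith) (by linarith)
    have h5 : 0 ≤ ∏ p ∈ oddPrimesUpTo y \ B, (1 + 1 / ((p : ℝ) - 2)) :=
      Finset.prod_nonneg fun p hp => by
        have := h3 p (Finset.sdiff_subset hp)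
        have : 0 ≤ 1 / ((p : ℝ) - 2) := div_nonneg zero_le_one (by linarith)
        linarith
    have h6 := mul_le_mul_of_nonneg_left h4 (mul_nonneg h5 (Real.exp_pos (-t)).le)
    rw [mul_assoc, ← Real.exp_add, neg_add_cancel, Real.exp_zero, mul_one] at h6
    linarith
  have hQ := twinDensity_nonneg y
  have h7 := mul_le_mul_of_nonneg_left (hsmall.trans hBprod) hQ
  rw [mul_left_comm, hall] at h7
  have h8 : twinDensity y * tailSum H y = 2 * roughDensity y - twinDensity y *
      ∑ S ∈ (oddPrimesUpTo y).powerset with ¬ H ≤ ∏ p ∈ S, p, ∏ p ∈ S, (1 / ((p : ℝ) - 2)) := by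
    rw [← hall, ← hsplit]; ring
  rw [h8]
  have hP := roughDensity_nonneg y
  -- The tail is at least `2 * P * (1 - exp (-t))`, which this turns into `P * t`.
  have hexp : Real.exp (-t) ≤ 1 - t / 2 := by
    have h9 := Real.add_one_le_exp t
    rw [Real.exp_neg]
    refine (inv_anti₀ (by linarith) h9).trans ?_
    rw [inv_le_iff_one_le_mul₀ (by linarith)]
    nlinarith
  nlinarith

/-- A crude Mertens bound: some power of `1 / log y`, which is `H ^ (-o(1))` as long as `y ≤ H ^ 2`.
-/
theorem exp_neg_le_twinDensity {y : ℕ} (hy : 2 ≤ y) :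
    Real.exp (-(48 * (1 + Real.log (3 * Real.log y)))) ≤ twinDensity y := by
  have hy' : (2 : ℝ) ≤ y := by exact_mod_cast hy
  have hT : ((Nat.log 2 y + 1 : ℕ) : ℝ) ≤ 3 * Real.log y := by
    have h1 : ((2 ^ Nat.log 2 y : ℕ) : ℝ) ≤ y := by
      exact_mod_cast Nat.pow_log_le_self 2 (by omega)
    have h2 := Real.log_le_log (by positivity) h1
    have h3 := Real.log_le_log (by norm_num) hy'
    push_cast at h2 ⊢
    rw [Real.log_pow] at h2
    have h4 := Real.log_two_gt_d9
    have h5 : 1 ≤ Nat.log 2 y := Nat.log_pos (by norm_num) hy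
    have h6 : (1 : ℝ) ≤ Nat.log 2 y := by exact_mod_cast h5
    nlinarith
  have hsum := sum_inv_primes_le (T := Nat.log 2 y + 1) (by omega) (oddPrimesUpTo y)
    (fun p hp => (mem_oddPrimesUpTo.mp hp).1) fun p hp q hq =>
      calc q ≤ y := (mem_oddPrimesUpTo.mp hq).2.2
        _ < 2 ^ (Nat.log 2 y + 1) := Nat.lt_pow_succ_log_self (by norm_num) y
        _ ≤ p ^ (Nat.log 2 y + 1) :=
          Nat.pow_le_pow_left (mem_oddPrimesUpTo.mp hp).1.two_le _
  have hlog := Real.log_le_log (by positivity) hT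
  calc Real.exp (-(48 * (1 + Real.log (3 * Real.log y)))) ≤
        Real.exp (∑ p ∈ oddPrimesUpTo y, -(6 * (1 / p : ℝ))) := by
        rw [Finset.sum_neg_distrib, ← Finset.mul_sum]
        refine Real.exp_le_exp.mpr ?_
        linarith
    _ ≤ twinDensity y := by
        rw [Real.exp_sum]
        exact Finset.prod_le_prod (fun _ _ => (Real.exp_pos _).le) fun p hp =>
          exp_neg_le_one_sub_two_div (mem_oddPrimesUpTo.mp hp).2.1

theorem eventually_le_primeCounting :
    ∀ᶠ n : ℕ in atTop, (n : ℝ) / (2 * Real.log n) ≤ (Nat.primeCounting n : ℝ) := by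
  have hlo := tendsto_natCast_atTop_atTop (R := ℝ) |>.eventually
    (Real.isLittleO_log_id_atTop.bound (by norm_num : (0 : ℝ) < 1 / 20))
  filter_upwards [hlo, eventually_ge_atTop 20] with n h1 h2
  have h2' : (20 : ℝ) ≤ n := by exact_mod_cast h2
  have hl : 0 < Real.log n := Real.log_pos (by linarith)
  simp only [id] at h1
  rw [Real.norm_of_nonneg hl.le, Real.norm_of_nonneg (by linarith)] at h1
  refine le_trans ?_ (Chebyshev.pi_ge n)
  have h3 : Real.log (n + 1) ≤ Real.log 2 + Real.log n := by
    rw [← Real.log_mul (by norm_num) (by positivity)]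
    exact Real.log_le_log (by linarith) (by linarith)
  have := Real.log_two_gt_d9
  have := Real.log_two_lt_d9
  have h4 : (n : ℝ) / 2 ≤ n * Real.log 2 - Real.log (n + 1) := by nlinarith
  rw [div_le_div_iff₀ (by positivity) hl]
  nlinarith

theorem primeCounting_le_card (n : ℕ) (z : ℝ) (hz : 2 ≤ z) :
    (Nat.primeCounting n : ℝ) ≤ ((oddPrimesUpTo n).filter fun p : ℕ => z < (p : ℝ)).card + z := by
  rw [← Nat.primesLE_card_eq_primeCounting]
  have hsub : n.primesLE ⊆ ((oddPrimesUpTo n).filter fun p : ℕ => z < (p : ℝ)) ∪ Finset.Icc 1 ⌊z⌋₊ := by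
    intro p hp
    obtain ⟨hpn, hpp⟩ := Nat.mem_primesLE.mp hp
    rw [Finset.mem_union, Finset.mem_filter, Finset.mem_Icc, mem_oddPrimesUpTo]
    by_cases h : z < p
    · refine Or.inl ⟨⟨hpp, ?_, hpn⟩, h⟩
      have : (2 : ℝ) < p := by linarith
      exact_mod_cast this
    · exact Or.inr ⟨hpp.one_lt.le, Nat.le_floor (not_lt.mp h)⟩
  have h := (Finset.card_le_card hsub).trans (Finset.card_union_le _ _)
  rw [Nat.card_Icc, Nat.add_sub_cancel] at h
  have h' : (n.primesLE.card : ℝ) ≤ ((oddPrimesUpTo n).filter fun p : ℕ => z < (p : ℝ)).card + ⌊z⌋₊ := by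
    exact_mod_cast h
  have := Nat.floor_le (by linarith : 0 ≤ z)
  linarith

theorem eventually_mul_le_exp (C : ℝ) {η : ℝ} (hη : 0 < η) :
    ∀ᶠ t : ℝ in atTop, C * t ≤ Real.exp (η * t) := by
  have h := (isLittleO_pow_exp_pos_mul_atTop 1 hη).bound
    (by positivity : (0 : ℝ) < 1 / (|C| + 1))
  filter_upwards [h, eventually_ge_atTop 0] with t h1 h2
  rw [pow_one, Real.norm_of_nonneg h2, Real.norm_of_nonneg (Real.exp_pos _).le,
    one_div_mul_eq_div, le_div_iff₀ (by positivity)] at h1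
  have := le_abs_self C
  nlinarith

theorem eventually_log_le_mul {η : ℝ} (hη : 0 < η) : ∀ᶠ t : ℝ in atTop, Real.log t ≤ η * t := by
  filter_upwards [Real.isLittleO_log_id_atTop.bound hη, eventually_ge_atTop 1] with t h1 h2
  simp only [id] at h1
  rwa [Real.norm_of_nonneg (Real.log_nonneg h2), Real.norm_of_nonneg (by linarith)] at h1

/-- Chebyshev gives at least `H ^ 2 / (8 * log H)` primes in `(H, H ^ 2]`, each with reciprocal at
least `1 / H ^ 2`. -/
theorem le_M_of_sq_lt {H y : ℕ} (hHy : H ^ 2 < y)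
    (hπ : ((H ^ 2 : ℕ) : ℝ) / (2 * Real.log (H ^ 2 : ℕ)) ≤ (Nat.primeCounting (H ^ 2) : ℝ))
    (hlog : 1 ≤ Real.log H) (hlogH : 8 * Real.log H ≤ H) :
    roughDensity y * (H / (32 * Real.log H)) ≤ M H y := by
  have hH8 : (8 : ℝ) ≤ H := by linarith
  have hH8' : 8 ≤ H := by exact_mod_cast hH8
  have hy : 2 ≤ y := by nlinarith
  set B := (oddPrimesUpTo (H ^ 2)).filter fun p : ℕ => (H : ℝ) < (p : ℝ) with hBdef
  have hBmem : ∀ p ∈ B, (p.Prime ∧ 3 ≤ p ∧ p ≤ H ^ 2) ∧ H < p := fun p hp => by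
    obtain ⟨h1, h2⟩ := Finset.mem_filter.mp hp
    exact ⟨mem_oddPrimesUpTo.mp h1, by exact_mod_cast h2⟩
  have hcard := primeCounting_le_card (H ^ 2) H (by linarith)
  have hsum : 1 / (8 * Real.log H) ≤ ∑ p ∈ B, (1 / p : ℝ) := by
    have h1 : B.card • (1 / (H : ℝ) ^ 2) ≤ ∑ p ∈ B, (1 / p : ℝ) := by
      refine Finset.card_nsmul_le_sum _ _ _ fun p hp => ?_
      obtain ⟨⟨hpp, -, hpH⟩, -⟩ := hBmem p hp
      have hp0 : (0 : ℝ) < p := by exact_mod_cast hpp.pos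
      exact one_div_le_one_div_of_le hp0 (by exact_mod_cast hpH)
    refine le_trans ?_ h1
    rw [nsmul_eq_mul, mul_one_div, div_le_div_iff₀ (by positivity) (by positivity)]
    have h2 := hπ.trans hcard
    push_cast at h2
    rw [Real.log_pow, div_le_iff₀ (by norm_num; linarith)] at h2
    push_cast at h2
    have h3 : (H : ℝ) * (4 * Real.log H) ≤ H ^ 2 / 2 := by nlinarith
    nlinarith
  have hmain := le_twinDensity_mul_tailSum (H := H) (t := 1 / (8 * Real.log H)) hy B
    (fun p hp => ?_) (fun p hp => (hBmem p hp).2) (by positivity) ?_ hsum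
  · refine le_trans (le_of_eq ?_)
      ((mul_le_mul_of_nonneg_left hmain (by positivity : (0 : ℝ) ≤ H / 4)).trans (le_M H y))
    field_simp; ring
  · obtain ⟨⟨h1, h2, h3⟩, -⟩ := hBmem p hp
    exact mem_oddPrimesUpTo.mpr ⟨h1, h2, by omega⟩
  · rw [div_le_one (by positivity)]; linarith

/-- With `z = y ^ (1 - η)` there are at least `2 * z` primes in `(z, y]`. Any `K` of them have
product at least `z ^ K ≥ H` and weight at least `y ^ (-K)`, and there are at least `z ^ K / K! ≥ (z
/ log H) ^ K` such sets. -/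
theorem exp_neg_le_tailSum {H y K : ℕ} {η : ℝ} (hy : 2 ≤ y) (hH : 1 < H) (hη1 : η < 1)
    (hlog : 1 ≤ Real.log H)
    (hπ : (y : ℝ) / (2 * Real.log y) ≤ (Nat.primeCounting y : ℝ))
    (h6 : 6 * Real.log y ≤ Real.exp (η * Real.log y))
    (h2 : 2 ≤ (1 - η) * Real.log y)
    (hLL : Real.log (Real.log H) ≤ (1 - η) * Real.log y)
    (hK : Real.log H ≤ K * ((1 - η) * Real.log y)) (hKH : (K : ℝ) ≤ Real.log H) :
    Real.exp (-(K * (η * Real.log y + Real.log (Real.log H)))) ≤ tailSum H y := by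
  have hy0 : (0 : ℝ) < y := by exact_mod_cast (by omega : 0 < y)
  have hH0 : (0 : ℝ) < H := by exact_mod_cast (by omega : 0 < H)
  have hly : 0 < Real.log y := by nlinarith
  set z := Real.exp ((1 - η) * Real.log y) with hz
  have hz2 : 2 ≤ z := by linarith [Real.add_one_le_exp ((1 - η) * Real.log y)]
  set A := (oddPrimesUpTo y).filter fun p : ℕ => z < (p : ℝ) with hA
  have hyz : (y : ℝ) = z * Real.exp (η * Real.log y) := by
    rw [hz, ← Real.exp_add, ← add_mul, sub_add_cancel, one_mul, Real.exp_log hy0]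
  have hcard : 2 * z ≤ A.card := by
    have h3 := hπ.trans (primeCounting_le_card y z hz2)
    rw [div_le_iff₀ (by positivity)] at h3
    have h4 : z * (6 * Real.log y) ≤ y :=
      (mul_le_mul_of_nonneg_left h6 (by linarith)).trans hyz.ge
    have h5 : (3 * z) * (2 * Real.log y) ≤ (A.card + z) * (2 * Real.log y) := by linarith
    have := le_of_mul_le_mul_right h5 (by positivity)
    linarith
  -- Here `y` must exceed a power of `log H` with exponent above 1: `K ≤ log H ≤ y ^ (1 - η)`.
  have hKz : (K : ℝ) ≤ z := by
    refine hKH.trans ?_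
    rwa [hz, ← Real.log_le_iff_le_exp (by linarith)]
  have hHz : (H : ℝ) ≤ z ^ K := by
    rw [hz, ← Real.exp_nat_mul, ← Real.log_le_iff_le_exp hH0]
    exact hK
  refine le_trans ?_ (le_tailSum (by positivity) hHz A (Finset.filter_subset _ _)
    fun p hp => (Finset.mem_filter.mp hp).2.le)
  have hK1 : K ≤ A.card + 1 := by
    have : (K : ℝ) ≤ (A.card + 1 : ℕ) := by push_cast; linarith
    exact_mod_cast this
  have hch := Nat.pow_le_choose (α := ℝ) K A.card
  have hsub : z ≤ ((A.card + 1 - K : ℕ) : ℝ) := by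
    rw [Nat.cast_sub hK1]; push_cast; linarith
  have hf : (K.factorial : ℝ) ≤ Real.log H ^ K := by
    have h7 : (K.factorial : ℝ) ≤ (K : ℝ) ^ K := by exact_mod_cast Nat.factorial_le_pow K
    exact h7.trans (by gcongr)
  have h8 : (z / Real.log H) ^ K ≤ (A.card.choose K : ℝ) := by
    refine le_trans ?_ hch
    rw [div_pow]
    gcongr
  have h9 : Real.exp (-(K * (η * Real.log y + Real.log (Real.log H)))) =
      (z / Real.log H) ^ K * (1 / (y : ℝ)) ^ K := by
    rw [← mul_pow, neg_mul_eq_mul_neg, Real.exp_nat_mul]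
    congr 1
    have h10 : z / Real.log H * (1 / (y : ℝ)) =
        Real.exp ((1 - η) * Real.log y - Real.log (Real.log H) - Real.log y) := by
      rw [Real.exp_sub, Real.exp_sub, Real.exp_log hy0, Real.exp_log (by linarith), mul_one_div]
    rw [h10]
    congr 1; ring
  rw [h9]
  gcongr

/-- With `K` about `lH / ly` the product is about `(η + LL / ly) * lH`; rounding `K` and the factor
`1 / (1 - η)` cost a few more `η * lH`. -/
theorem mul_add_le_of_le {K lH ly LL η : ℝ} (hη : 0 < η) (hη2 : η ≤ 1 / 2) (hly : 0 < ly)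
    (hLL0 : 0 ≤ LL) (hLL : LL ≤ ly) (hlyH : ly ≤ 2 * lH) (hLLH : LL ≤ η * lH)
    (hK : K ≤ lH / ((1 - η) * ly) + 1) : K * (η * ly + LL) ≤ (LL / ly + 7 * η) * lH := by
  have hlH : 0 < lH := by linarith
  obtain ⟨q, hq⟩ : ∃ q, q = lH / ly := ⟨_, rfl⟩
  have hq0 : 0 ≤ q := by rw [hq]; positivity
  have hql : q * ly = lH := by rw [hq]; field_simp
  have hqL : LL / ly * lH = q * LL := by rw [hq]; field_simp
  have h1 : lH / ((1 - η) * ly) ≤ (1 + 2 * η) * q := by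
    have h1η : 0 < 1 - η := by linarith
    rw [div_le_iff₀ (by positivity), ← hql]
    have : 1 ≤ (1 + 2 * η) * (1 - η) := by nlinarith
    have h2 := mul_le_mul_of_nonneg_right this (mul_nonneg hq0 hly.le)
    linarith
  have h2 : K * (η * ly + LL) ≤ ((1 + 2 * η) * q + 1) * (η * ly + LL) :=
    mul_le_mul_of_nonneg_right (by linarith) (by positivity)
  have h3 : ((1 + 2 * η) * q + 1) * (η * ly + LL) =
      (1 + 2 * η) * (η * lH + q * LL) + η * ly + LL := by rw [← hql]; ring
  have h4 : q * LL ≤ lH := hql ▸ mul_le_mul_of_nonneg_left hLL hq0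
  have h5 : η * (q * LL) ≤ η * lH := mul_le_mul_of_nonneg_left h4 hη.le
  have h6 : η * (η * lH) ≤ 1 / 2 * (η * lH) := mul_le_mul_of_nonneg_right hη2 (by positivity)
  have h7 : η * ly ≤ η * (2 * lH) := mul_le_mul_of_nonneg_left hlyH hη.le
  rw [add_mul, hqL]
  linarith

/-- The main term is at least `roughDensity y * H ^ (1 - a - o(1))`. -/
theorem eventually_le_M {ι : Type*} {l : Filter ι} {H y : ι → ℕ} (hH : Tendsto H l atTop)
    (hy : Tendsto y l atTop) {ε : ℝ}
    (hyH : ∀ᶠ i in l, (1 + ε) * Real.log (Real.log (H i)) ≤ Real.log (y i))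
    {η : ℝ} (hη : 0 < η) (hη2 : η ≤ 1 / 2) (hηε : η * (1 + ε) ≤ ε) :
    ∀ᶠ i in l, roughDensity (y i) * (H i * Real.exp (-((Real.log (Real.log (H i)) /
      Real.log (y i) + 9 * η) * Real.log (H i)))) ≤ M (H i) (y i) := by
  have hlH : Tendsto (fun i => Real.log (H i)) l atTop :=
    Real.tendsto_log_atTop.comp (tendsto_natCast_atTop_atTop.comp hH)
  have hly : Tendsto (fun i => Real.log (y i)) l atTop :=
    Real.tendsto_log_atTop.comp (tendsto_natCast_atTop_atTop.comp hy)
  have hH2 : Tendsto (fun i => H i ^ 2) l atTop :=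
    (tendsto_pow_atTop two_ne_zero).comp hH
  have h6t : Tendsto (fun t : ℝ => 6 * t) atTop atTop :=
    tendsto_id.const_mul_atTop (by norm_num)
  have hε0 : 0 < ε := by nlinarith
  filter_upwards [hyH, hlH.eventually (eventually_mul_le_exp 32 hη),
    hlH.eventually (eventually_mul_le_exp 8 one_pos),
    hlH.eventually (h6t.eventually (eventually_log_le_mul (by positivity : 0 < η / 576))),
    hlH.eventually (eventually_log_le_mul hη), hlH.eventually_ge_atTop 2,
    hlH.eventually_ge_atTop (96 / η), hH2.eventually eventually_le_primeCounting,
    hy.eventually eventually_le_primeCounting, hly.eventually (eventually_mul_le_exp 6 hη),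
    hly.eventually_ge_atTop 4, hy.eventually_ge_atTop 2, hH.eventually_ge_atTop 2]
    with i h1 h2 h3 h4 h5 h6 h7 h8 h9 h10 h11 h12 h13
  set lH := Real.log (H i) with hlHdef
  set ly := Real.log (y i) with hlydef
  set LL := Real.log lH with hLLdef
  have hH0 : (0 : ℝ) < H i := by exact_mod_cast (by omega : 0 < H i)
  have hLL0 : 0 ≤ LL := Real.log_nonneg (by linarith)
  have ha0 : 0 ≤ LL / ly := div_nonneg hLL0 (by linarith)
  have hP0 := roughDensity_nonneg (y i)
  have hP1 := roughDensity_le_one (y i)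
  by_cases hc : H i ^ 2 < y i
  · have h14 : 8 * lH ≤ H i := by
      rw [one_mul, Real.exp_log hH0] at h3; exact h3
    refine le_trans ?_ (le_M_of_sq_lt hc h8 (by linarith) h14)
    refine mul_le_mul_of_nonneg_left ?_ hP0
    rw [div_eq_mul_one_div (H i : ℝ)]
    refine mul_le_mul_of_nonneg_left ?_ hH0.le
    rw [Real.exp_neg, ← one_div]
    refine one_div_le_one_div_of_le (by positivity) (h2.trans (Real.exp_le_exp.mpr ?_))
    have : 0 ≤ LL / ly * lH := mul_nonneg ha0 (by linarith)
    nlinarith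
  · have hly2 : ly ≤ 2 * lH := by
      have h14 : (y i : ℝ) ≤ (H i : ℝ) ^ 2 := by exact_mod_cast not_lt.mp hc
      have h15 := Real.log_le_log (by positivity) h14
      rwa [Real.log_pow] at h15
    have h1η : 0 < 1 - η := by linarith
    have hly2' : 2 ≤ (1 - η) * ly := by nlinarith
    have hly0 : 0 < ly := by linarith
    have hLL : LL ≤ (1 - η) * ly := by
      have h14 : 1 ≤ (1 - η) * (1 + ε) := by nlinarith
      have h15 : (1 - η) * ((1 + ε) * LL) ≤ (1 - η) * ly :=
        mul_le_mul_of_nonneg_left h1 h1η.le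
      nlinarith
    set K := ⌈lH / ((1 - η) * ly)⌉₊ with hKdef
    have hK1 : lH ≤ K * ((1 - η) * ly) := by
      have := Nat.le_ceil (lH / ((1 - η) * ly))
      rwa [div_le_iff₀ (by linarith)] at this
    have hK2 : (K : ℝ) ≤ lH / ((1 - η) * ly) + 1 :=
      (Nat.ceil_lt_add_one (div_nonneg (by linarith) (by linarith))).le
    have hK3 : (K : ℝ) ≤ lH := by
      have : lH / ((1 - η) * ly) ≤ lH / 2 := by gcongr
      linarith
    have htail := exp_neg_le_tailSum (H := H i) h12 (by omega) (by linarith)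
      (by linarith) h9 h10 hly2' hLL hK1 hK3
    have hexp : K * (η * ly + LL) ≤ (LL / ly + 7 * η) * lH :=
      mul_add_le_of_le hη hη2 hly0 hLL0 (by nlinarith) hly2 h5 hK2
    have hQ : Real.exp (-(η * lH)) ≤ twinDensity (y i) := by
      refine le_trans (Real.exp_le_exp.mpr ?_) (exp_neg_le_twinDensity h12)
      have h23 : Real.log (3 * ly) ≤ Real.log (6 * lH) :=
        Real.log_le_log (by positivity) (by linarith)
      have h24 : 96 ≤ lH * η := by rwa [div_le_iff₀ hη] at h7
      linarith
    have h25 : 4 ≤ Real.exp (η * lH) := by linarith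
    -- Of the `9 * η`, the tail takes `7 * η`, `twinDensity` takes `η`, and the constant `1 / 4`
    -- takes `η`; `P` is bounded by 1.
    refine le_trans ?_ (le_M (H i) (y i))
    calc roughDensity (y i) * (H i * Real.exp (-((LL / ly + 9 * η) * lH))) ≤
          1 * (H i * Real.exp (-((LL / ly + 9 * η) * lH))) := by gcongr
      _ = H i * Real.exp (-(η * lH)) * (Real.exp (-(η * lH)) *
            Real.exp (-((LL / ly + 7 * η) * lH))) := by
          rw [one_mul, mul_assoc, ← Real.exp_add, ← Real.exp_add]; congr 2; ring
      _ ≤ H i / 4 * (twinDensity (y i) * tailSum (H i) (y i)) := by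
          have h26 : Real.exp (-((LL / ly + 7 * η) * lH)) ≤ tailSum (H i) (y i) :=
            (Real.exp_le_exp.mpr (neg_le_neg hexp)).trans htail
          have h27 : Real.exp (-(η * lH)) ≤ 1 / 4 := by
            rw [Real.exp_neg, ← one_div]
            exact one_div_le_one_div_of_le (by norm_num) h25
          have h28 : (H i : ℝ) * Real.exp (-(η * lH)) ≤ H i / 4 := by
            have := mul_le_mul_of_nonneg_left h27 hH0.le
            linarith
          have := twinDensity_nonneg (y i)
          gcongr

/-! ### Choice of the truncation level -/

/-- With the level of truncation chosen in terms of `H` and `y`, the sieve applies to intervals of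
length `X`, and it saves a factor `H ^ (1 + a + δ / 4)`. -/
theorem exists_sieve_level {X y : ℕ} {δ : ℝ} (hδ : 0 < δ) (hδ2 : δ ≤ 1 / 2) (hy : 2 ≤ y)
    (hX : 0 < X) {lH ly LL : ℝ} (hly : ly = Real.log y) (hly0 : 0 < ly)
    (hLL1 : 8 ≤ LL) (hlH : 2 ≤ lH) (hLLy : LL ≤ ly) (hlHy : lH ≤ y)
    (hL : 60 / δ ≤ lH / LL) (hloglog : Real.log LL ≤ δ / 16 * LL) (hLLdef : LL = Real.log lH)
    (hsieve : (1 + LL / ly) * (lH / LL) ≤ (1 - δ) * (Real.log X / ly))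
    (hsav : ∀ k : ℕ, lH / LL ≤ k →
      sieveSaving k ≤ Real.exp (-((1 - δ / 16) * (k * Real.log k)))) :
    ∃ k : ℕ, 0 < k ∧ Even k ∧ k + 1 ≤ 2 * y ∧ y ^ (k + 28) ≤ X ∧
      sieveSaving k ≤ Real.exp (-((1 + LL / ly + δ / 4) * lH)) := by
  obtain ⟨L, hLdef⟩ : ∃ L, L = lH / LL := ⟨_, rfl⟩
  obtain ⟨a, ha⟩ : ∃ a, a = LL / ly := ⟨_, rfl⟩
  rw [← hLdef] at hL hsieve hsav
  rw [← ha] at hsieve ⊢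
  have hLLpos : 0 < LL := by linarith
  have ha0 : 0 ≤ a := by rw [ha]; positivity
  have ha1 : a ≤ 1 := by rw [ha, div_le_one hly0]; exact hLLy
  have hLlH : L * LL = lH := by rw [hLdef]; field_simp
  have hL0 : 0 < L := lt_of_lt_of_le (by positivity) hL
  obtain ⟨B, hB⟩ : ∃ B, B = (1 + a) * L := ⟨_, rfl⟩
  rw [← hB] at hsieve
  have hBL : L ≤ B := by rw [hB]; nlinarith
  have hBL2 : B ≤ 2 * L := by rw [hB]; nlinarith
  -- The level `2 * n` is even and just above `(1 + δ / 2) * B`: beyond `B`, so that the saving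
  -- beats the loss in `M`, yet within `log X / log y` since `(1 + δ / 2) * (1 - δ) ≤ 1 - δ / 2`.
  set n := ⌈(1 + δ / 2) * B / 2⌉₊ with hn
  have hn1 : (1 + δ / 2) * B / 2 ≤ n := Nat.le_ceil _
  have hn2 : (n : ℝ) ≤ (1 + δ / 2) * B / 2 + 1 :=
    (Nat.ceil_lt_add_one (by have : 0 < B := by linarith
                             positivity)).le
  have hδB : 0 ≤ δ * B := mul_nonneg hδ.le (by linarith)
  refine ⟨2 * n, ?_, even_two_mul n, ?_, ?_, ?_⟩
  · have : 0 < n := Nat.ceil_pos.mpr (by have : 0 < B := by linarith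
                                         positivity)
    omega
  · have h1 : ((2 * n + 1 : ℕ) : ℝ) ≤ ((2 * y : ℕ) : ℝ) := by
      push_cast
      have h2 : L ≤ lH / 8 := by rw [hLdef]; gcongr
      have h3 : δ * B ≤ 1 / 2 * B := mul_le_mul_of_nonneg_right hδ2 (by linarith)
      linarith
    exact_mod_cast h1
  · obtain ⟨u, hu⟩ : ∃ u, u = Real.log X / ly := ⟨_, rfl⟩
    rw [← hu] at hsieve
    have hul : u * ly = Real.log X := by rw [hu]; field_simp
    have hu0 : 0 ≤ u := by nlinarith
    have huB : B ≤ u := by nlinarith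
    have hLδ : 60 ≤ L * δ := by rwa [div_le_iff₀ hδ] at hL
    -- Rounding costs 2, so the spare `δ * u / 2` must cover `2 + 28 = 30`; this is why `L ≥ 60 / δ`
    -- is assumed.
    have h1 : ((2 * n : ℕ) : ℝ) + 28 ≤ u := by
      push_cast
      have h2 : (1 + δ / 2) * B ≤ (1 + δ / 2) * ((1 - δ) * u) :=
        mul_le_mul_of_nonneg_left hsieve (by positivity)
      have h3 : L * δ ≤ u * δ := mul_le_mul_of_nonneg_right (by linarith) hδ.le
      have h4 : 0 ≤ δ * δ * u := by positivity
      nlinarith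
    have h5 : ((y ^ (2 * n + 28) : ℕ) : ℝ) ≤ (X : ℝ) := by
      have hy0 : (0 : ℝ) < y := by exact_mod_cast (by omega : 0 < y)
      have hX0 : (0 : ℝ) < X := by exact_mod_cast hX
      push_cast
      rw [← Real.log_le_log_iff (by positivity) hX0, Real.log_pow, ← hul, ← hly]
      refine mul_le_mul_of_nonneg_right ?_ hly0.le
      push_cast at h1 ⊢
      exact h1
    exact_mod_cast h5
  · have hk : (1 + δ / 2) * B ≤ ((2 * n : ℕ) : ℝ) := by push_cast; linarith
    have hkL : L ≤ ((2 * n : ℕ) : ℝ) := by linarith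
    refine (hsav (2 * n) hkL).trans (Real.exp_le_exp.mpr (neg_le_neg ?_))
    -- Here `log L = LL - log LL`, and `log LL` is negligible.
    have hlogL : (1 - δ / 16) * LL ≤ Real.log ((2 * n : ℕ) : ℝ) := by
      refine le_trans ?_ (Real.log_le_log hL0 hkL)
      rw [hLdef, Real.log_div (by linarith) hLLpos.ne', ← hLLdef]
      linarith
    have h1 : (1 + δ / 2) * B * ((1 - δ / 16) * LL) ≤
        ((2 * n : ℕ) : ℝ) * Real.log ((2 * n : ℕ) : ℝ) :=
      mul_le_mul hk hlogL (mul_nonneg (by linarith) hLLpos.le) (Nat.cast_nonneg _)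
    have h2 := mul_le_mul_of_nonneg_left h1 (by linarith : 0 ≤ 1 - δ / 16)
    refine le_trans ?_ h2
    have h3 : (1 - δ / 16) * ((1 + δ / 2) * B * ((1 - δ / 16) * LL)) =
        (1 - δ / 16) * (1 - δ / 16) * (1 + δ / 2) * ((1 + a) * lH) := by
      rw [hB, ← hLlH]; ring
    rw [h3]
    have h4 : 1 + δ / 4 ≤ (1 - δ / 16) * (1 - δ / 16) * (1 + δ / 2) := by
      have e : (1 - δ / 16) * (1 - δ / 16) * (1 + δ / 2) =
          1 + δ / 4 + (δ * (1 / 2 - δ) * (15 / 256) + δ * (49 / 512) + δ ^ 3 / 512) := by ring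
      have := mul_nonneg hδ.le (sub_nonneg.mpr hδ2)
      rw [e]
      exact le_add_of_nonneg_right (by positivity)
    have h5 : 0 ≤ (1 + a) * lH := mul_nonneg (by linarith) (by linarith)
    refine le_trans ?_ (mul_le_mul_of_nonneg_right h4 h5)
    have h6 : 0 ≤ δ * (a * lH) := mul_nonneg hδ.le (mul_nonneg ha0 (by linarith))
    have e : (1 + δ / 4) * ((1 + a) * lH) = (1 + a + δ / 4) * lH + δ * (a * lH) / 4 := by ring
    rw [e]
    linarith

end RoughVariance

end

/-! ### The asymptotic formula -/

theorem theorem1 {ι : Type*} (l : Filter ι) (X H y : ι → ℕ) (ε δ : ℝ)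
    (hε : 0 < ε) (hδ : 0 < δ)
    (hX : Tendsto X l atTop) (hH : Tendsto H l atTop) (hy : Tendsto y l atTop)
    (hyX : ∀ᶠ i in l, y i ≤ X i) (hHX : ∀ᶠ i in l, H i ≤ X i)
    (hyH : ∀ᶠ i in l, Real.log (H i) ^ (1 + ε) ≤ (y i : ℝ))
    (hsieve : ∀ᶠ i in l,
      (1 + Real.log (Real.log (H i)) / Real.log (y i)) *
          (Real.log (H i) / Real.log (Real.log (H i))) ≤
        (1 - δ) * (Real.log (X i) / Real.log (y i))) :
    (fun i => RoughVariance.V (X i) (H i) (y i)) ~[l]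
      (fun i => RoughVariance.M (H i) (y i)) := by
  have hlH : Tendsto (fun i => Real.log (H i)) l atTop :=
    Real.tendsto_log_atTop.comp (tendsto_natCast_atTop_atTop.comp hH)
  have hLL : Tendsto (fun i => Real.log (Real.log (H i))) l atTop :=
    Real.tendsto_log_atTop.comp hlH
  have hly : Tendsto (fun i => Real.log (y i)) l atTop :=
    Real.tendsto_log_atTop.comp (tendsto_natCast_atTop_atTop.comp hy)
  have hlogy : ∀ᶠ i in l, (1 + ε) * Real.log (Real.log (H i)) ≤ Real.log (y i) := by
    filter_upwards [hyH, hlH.eventually_gt_atTop 0] with i h1 h2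
    have := Real.log_le_log (Real.rpow_pos_of_pos h2 _) h1
    rwa [Real.log_rpow h2] at this
  obtain ⟨δ', hδ'0, hδ'1, hδ'2⟩ : ∃ δ', 0 < δ' ∧ δ' ≤ δ ∧ δ' ≤ 1 / 2 :=
    ⟨min δ (1 / 2), by positivity, min_le_left _ _, min_le_right _ _⟩
  obtain ⟨η, hη0, hη1, hη2, hη3⟩ : ∃ η, 0 < η ∧ η ≤ 1 / 2 ∧ η * (1 + ε) ≤ ε ∧ 9 * η ≤ δ' / 8 := by
    refine ⟨min (ε / (1 + ε)) (δ' / 72), by positivity, ?_, ?_, ?_⟩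
    · exact (min_le_right _ _).trans (by linarith)
    · rw [← le_div_iff₀ (by positivity)]; exact min_le_left _ _
    · linarith [min_le_right (ε / (1 + ε)) (δ' / 72)]
  have hL : Tendsto (fun i => Real.log (H i) / Real.log (Real.log (H i))) l atTop := by
    have h1 : Tendsto (fun t : ℝ => t / Real.log t) atTop atTop := by
      have h2 := Real.isLittleO_log_id_atTop.tendsto_div_nhds_zero
      have h3 : Tendsto (fun t : ℝ => Real.log t / id t) atTop (nhdsWithin 0 (Set.Ioi 0)) := by
        refine tendsto_nhdsWithin_iff.mpr ⟨h2, ?_⟩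
        filter_upwards [eventually_gt_atTop 1] with t ht
        exact div_pos (Real.log_pos ht) (by simp only [id]; linarith)
      refine (tendsto_inv_nhdsGT_zero.comp h3).congr fun t => ?_
      simp only [Function.comp, id, inv_div]
    exact h1.comp hlH
  obtain ⟨k₀, hk₀⟩ := eventually_atTop.mp
    (RoughVariance.eventually_sieveSaving_le (η := δ' / 16) (by positivity))
  refine IsLittleO.of_bound fun c hc => ?_
  -- The ratio of error to main term will be at most `21 * H ^ (-δ' / 8)`, where `21 = 3 * 7`.
  have hdecay : ∀ᶠ t : ℝ in atTop, 21 * Real.exp (-(δ' / 8 * t)) ≤ c := by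
    filter_upwards [RoughVariance.eventually_mul_le_exp (21 / c) (by positivity : 0 < δ' / 8),
      eventually_ge_atTop 1] with t h1 h2
    rw [Real.exp_neg, ← div_eq_mul_inv, div_le_iff₀ (Real.exp_pos _), ← div_le_iff₀' hc]
    refine le_trans ?_ h1
    exact le_mul_of_one_le_right (by positivity) h2
  filter_upwards [hyH, hlogy, hsieve, hX.eventually_gt_atTop 0, hy.eventually_ge_atTop 2,
    hly.eventually_gt_atTop 0, hLL.eventually_ge_atTop 8, hlH.eventually_ge_atTop 2,
    hL.eventually_ge_atTop (60 / δ'), hL.eventually_ge_atTop (k₀ : ℝ),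
    hLL.eventually (RoughVariance.eventually_log_le_mul (by positivity : 0 < δ' / 16)),
    RoughVariance.eventually_le_M hH hy hlogy hη0 hη1 hη2, hlH.eventually hdecay]
    with i h1 h2 h3 hX0 hy2 hly0 hLL8 hlH2 hL60 hLk hloglog hM hc'
  have hlHy : Real.log (H i) ≤ y i := by
    refine le_trans ?_ h1
    exact Real.self_le_rpow_of_one_le (by linarith) (by linarith)
  have hlX : 0 ≤ Real.log (X i) / Real.log (y i) :=
    div_nonneg (Real.log_natCast_nonneg _) hly0.le
  have hLLy : Real.log (Real.log (H i)) ≤ Real.log (y i) := by nlinarith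
  obtain ⟨k, hk0, hk, hky, hkX, hs⟩ := RoughVariance.exists_sieve_level hδ'0 hδ'2 hy2 hX0 rfl hly0
    hLL8 hlH2 hLLy hlHy hL60 hloglog rfl
    (h3.trans (mul_le_mul_of_nonneg_right (by linarith) hlX))
    fun k hk => hk₀ k (by exact_mod_cast hLk.trans hk)
  set lH := Real.log (H i) with hlHdef
  set a := Real.log lH / Real.log (y i) with ha
  have ha0 : 0 ≤ a := div_nonneg (by linarith) hly0.le
  have hs1 : RoughVariance.sieveSaving k ≤ 1 := by
    refine hs.trans (Real.exp_le_one_iff.mpr ?_)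
    rw [neg_nonpos]; exact mul_nonneg (by linarith) (by linarith)
  have hVM := RoughVariance.abs_V_sub_M_le (H := H i) hX0 hy2
    (RoughVariance.abs_pairCount_div_sub_le hk0 hk hy2 hky hkX hs1)
  have hH0 : (0 : ℝ) < H i := by
    rcases Nat.eq_zero_or_pos (H i) with h0 | h0
    · rw [hlHdef, h0] at hlH2; norm_num at hlH2
    · exact_mod_cast h0
  have hP := RoughVariance.roughDensity_nonneg (y i)
  have hHexp : (H i : ℝ) * Real.exp (-lH) = 1 := by
    rw [hlHdef, Real.exp_neg, Real.exp_log hH0, mul_inv_cancel₀ hH0.ne']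
  have hbound : 3 * (H i : ℝ) ^ 2 *
      (7 * (RoughVariance.roughDensity (y i) * RoughVariance.sieveSaving k)) ≤
      c * RoughVariance.M (H i) (y i) := by
    -- Half of the surplus `δ' / 4` pays for the loss `9 * η` in the lower bound for `M`; the other
    -- half is the decay. The factor `P` is common to both sides.
    have e1 : Real.exp (-((1 + a + δ' / 4) * lH)) ≤
        Real.exp (-lH) * (Real.exp (-((a + 9 * η) * lH)) * Real.exp (-(δ' / 8 * lH))) := by
      rw [← Real.exp_add, ← Real.exp_add]
      refine Real.exp_le_exp.mpr ?_
      have : 9 * η * lH ≤ δ' / 8 * lH := mul_le_mul_of_nonneg_right hη3 (by linarith)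
      nlinarith
    calc 3 * (H i : ℝ) ^ 2 *
          (7 * (RoughVariance.roughDensity (y i) * RoughVariance.sieveSaving k)) ≤
          3 * (H i : ℝ) ^ 2 * (7 * (RoughVariance.roughDensity (y i) * (Real.exp (-lH) *
            (Real.exp (-((a + 9 * η) * lH)) * Real.exp (-(δ' / 8 * lH)))))) := by
          have := hs.trans e1
          gcongr
      _ = (21 * Real.exp (-(δ' / 8 * lH))) * (RoughVariance.roughDensity (y i) *
            (H i * Real.exp (-((a + 9 * η) * lH)))) * ((H i : ℝ) * Real.exp (-lH)) := by ring
      _ ≤ c * RoughVariance.M (H i) (y i) := by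
          rw [hHexp, mul_one]
          exact mul_le_mul hc' hM (by positivity) hc.le
  rw [Real.norm_eq_abs, Real.norm_eq_abs]
  refine (hVM.trans hbound).trans ?_
  exact mul_le_mul_of_nonneg_left (le_abs_self _) hc.le
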